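/- Let $p_1,p_2,p_3,\dots$ be the power sum symmetric functions and let $t$ be an indeterminate. Consider (completed) symmetric functions with coefficients in $\mathbb{Q}(t)$, that is, formal power series $f=f(p_1,p_2,\dots)$ in the power sums. The plethysm $f\circ g$, for $g$ without constant term, is obtained by replacing each $p_k$ in $f$ by $p_k\circ g$, where $p_k\circ g$ is obtained from $g$ by replacing each $p_l$ by $p_{kl}$ and $t$ by $t^k$. The suspension of $f$ is $$\Sigma_t f=-\tfrac1t\, f(-tp_1,-t^2p_2,-t^3p_3,\dots).$$ Let $\operatorname{Comm}=\exp\bigl(\sum_{k\ge1}p_k/k\bigr)-1$, and let $\operatorname{PreLie}=\sum_{n\geq 1}\operatorname{ch}(\operatorname{PreLie}(n))$, where $\operatorname{PreLie}(n)$ is the permutation representation of $\mathfrak S_n$ spanned by the rooted trees with vertex set $\{1,\dots,n\}$, and $\operatorname{ch}$ is the Frobenius characteristic $\operatorname{ch}(V)=\frac1{n!}\sum_{\sigma\in\mathfrak S_n}\chi_V(\sigma)\,p_{\operatorname{type}(\sigma)}$. For a partition $\lambda$, let $\lambda_k$ be the number of parts of $\lambda$ of size $k$, let $p_\lambda=\prod_k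 p_k^{\lambda_k}$ and $z_\lambda=\prod_k k^{\lambda_k}\lambda_k!$, and let $f_k(\lambda)$ be the number of fixed points of the $k$-th power of a permutation of cycle type $\lambda$. Then $$(\Sigma_t \operatorname{Comm})\circ\operatorname{PreLie}=\sum_{\lambda,\ |\lambda|\ge1}(\lambda_1-t)^{\lambda_1-1}\prod_{k\ge2}\Bigl((f_k(\lambda)-t^k)^{\lambda_k}-k\lambda_k\,(f_k(\lambda)-t^k)^{\lambda_k-1}\Bigr)\frac{p_\lambda}{z_\lambda},$$ where the sum is over all partitions $\lambda$ of positive integers, each monomial in the $p_k$ occurring in only finitely many terms. -/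

import Mathlib

open MvPowerSeries

noncomputable section

/-! ## The completed ring of symmetric functions

The coefficients are the rational functions over `ℚ` in one indeterminate `t`.  In characteristic
zero, the ring of symmetric functions (completed with respect to the degree) is the ring of formal
power series in the power sums `p 1, p 2, p 3, …`, which are algebraically independent. -/

/-- The field of coefficients `ℚ(t)`. -/
abbrev Coef : Type := RatFunc ℚ

/-- The indeterminate `t`. -/
def tVar : Coef := RatFunc.X

/-- Completed symmetric functions with coefficients in `ℚ(t)`, written in the power sums. -/
abbrev SymFn : Type := MvPowerSeries ℕ+ Coef

/-- The power sum `p_k`, for `k ≥ 1`. -/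
def pSum (k : ℕ+) : SymFn := X k

/-- The power sum `p_μ`, the product of the `p_k` over the parts `k` of the partition `μ`
(all parts are positive, so `Nat.toPNat'` only changes the type of `k`). -/
def pPart {n : ℕ} (μ : n.Partition) : SymFn :=
  (μ.parts.map fun k => pSum k.toPNat').prod

/-- The classical constant `z_μ = ∏ k ^ μ_k * μ_k !`, where `μ_k` is the number of parts of
size `k`. -/
def zPart {n : ℕ} (μ : n.Partition) : ℕ :=
  ∏ k ∈ μ.parts.toFinset, k ^ μ.parts.count k * (μ.parts.count k).factorial

/-- A family of series is locally finite if each monomial occurs in finitely many of its members;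
exactly such families have a formal sum. -/
def FormallySummable {ι : Type} (F : ι → SymFn) : Prop :=
  ∀ d : ℕ+ →₀ ℕ, {i | coeff d (F i) ≠ 0}.Finite

/-- The formal, coefficientwise, sum of a locally finite family of series. -/
def formalSum {ι : Type} (F : ι → SymFn) : SymFn :=
  fun d => ∑ᶠ i, coeff d (F i)

/-! ## Plethysm and suspension -/

theorem expand_nonZeroDivisors (k : ℕ+) :
    nonZeroDivisors (Polynomial ℚ) ≤
      (nonZeroDivisors (Polynomial ℚ)).comap (Polynomial.expand ℚ (k : ℕ)) := by
  intro f hf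
  rw [Submonoid.mem_comap, mem_nonZeroDivisors_iff_ne_zero]
  rw [mem_nonZeroDivisors_iff_ne_zero] at hf
  exact (Polynomial.expand_ne_zero k.pos).2 hf

/-- The endomorphism `c(t) ↦ c(t ^ k)` of the coefficients. -/
def coefAdams (k : ℕ+) : Coef →+* Coef :=
  RatFunc.mapRingHom (Polynomial.expand ℚ (k : ℕ)) (expand_nonZeroDivisors k)

/-- The plethysm `p_k ∘ g`: each `p_l` is replaced by `p_{kl}`, and `t` by `t ^ k`. -/
def adams (k : ℕ+) (g : SymFn) : SymFn :=
  subst (fun l : ℕ+ => pSum (k * l)) (MvPowerSeries.map (coefAdams k) g)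

/-- The plethysm `f ∘ g`, for `g` without constant term: each `p_k` in `f` is replaced by
`p_k ∘ g`. -/
def plethysm (f g : SymFn) : SymFn :=
  subst (fun k : ℕ+ => adams k g) f

/-- The suspension `Σ_t f = -(1/t) f(-t p_1, -t² p_2, -t³ p_3, …)`. -/
def suspension (f : SymFn) : SymFn :=
  C (-(1 / tVar)) * rescale (fun k : ℕ+ => -tVar ^ (k : ℕ)) f

/-- `Comm = exp (∑_{k ≥ 1} p_k / k) - 1`. -/
def symComm : SymFn :=
  PowerSeries.subst (formalSum fun k : ℕ+ => C (1 / ((k : ℕ) : Coef)) * pSum k)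
    (PowerSeries.exp Coef) - 1

/-! ## Frobenius characteristic and rooted trees -/

/-- The Frobenius characteristic `(1 / n!) ∑_σ χ(σ) p_{type(σ)}` of a representation of the
symmetric group on `n` letters.  Here `Equiv.Perm.partition` is the cycle type, fixed points
included. -/
def frobeniusChar {n : ℕ} {V : Type} [AddCommGroup V] [Module ℚ V]
    (ρ : Representation ℚ (Equiv.Perm (Fin n)) V) : SymFn :=
  C (1 / (n.factorial : Coef)) * ∑ σ : Equiv.Perm (Fin n),
    C (algebraMap ℚ Coef (LinearMap.trace ℚ V (ρ σ))) * pPart σ.partition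

/-- A rooted tree with vertex set `V`, all edges being oriented towards the root: every vertex
other than the root has an edge to its parent, and following the edges leads to the root.  The
value of `parent` at the root carries no information and is fixed to be the root. -/
@[ext]
structure LabelledRootedTree (V : Type) where
  root : V
  parent : V → V
  parent_root : parent root = root
  reaches_root : ∀ v, ∃ k : ℕ, parent^[k] v = root

theorem relabel_iterate {V : Type} (σ : Equiv.Perm V) (f : V → V) (k : ℕ) (v : V) :
    (fun w => σ (f (σ.symm w)))^[k] v = σ (f^[k] (σ.symm v)) := by
  induction k with
  | zero => simp
  | succ k ih => rw [Function.iterate_succ_apply', Function.iterate_succ_apply', ih]; simp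

/-- Relabelling the vertices of a rooted tree. -/
def LabelledRootedTree.relabel {V : Type} (σ : Equiv.Perm V) (T : LabelledRootedTree V) : LabelledRootedTree V where
  root := σ T.root
  parent v := σ (T.parent (σ.symm v))
  parent_root := by simp [T.parent_root]
  reaches_root v := by
    obtain ⟨k, hk⟩ := T.reaches_root (σ.symm v)
    exact ⟨k, by rw [relabel_iterate, hk]⟩

/-- Permutations of the vertices act on rooted trees by relabelling. -/
instance rootedTreeAction (V : Type) : MulAction (Equiv.Perm V) (LabelledRootedTree V) where
  smul σ T := T.relabel σ
  one_smul _ := rfl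
  mul_smul _ _ _ := rfl

/-- The symmetric function `PreLie` of rooted trees: the sum over `n` of the Frobenius
characteristics of the permutation representations spanned by the rooted trees on `n` labelled
vertices. -/
def symPreLie : SymFn :=
  formalSum fun n : ℕ =>
    frobeniusChar (Representation.ofMulAction ℚ (Equiv.Perm (Fin n)) (LabelledRootedTree (Fin n)))

/-! ## Fixed points of powers of a permutation of given cycle type -/

theorem exists_perm_of_type {n : ℕ} (μ : n.Partition) :
    ∃ σ : Equiv.Perm (Fin n), σ.partition.parts = μ.parts := by
  classical
  have hsplit : μ.parts.filter (2 ≤ ·) + Multiset.replicate (μ.parts.count 1) 1 = μ.parts := by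
    conv_rhs => rw [← Multiset.filter_add_not (2 ≤ ·) μ.parts]
    congr 1
    rw [← Multiset.filter_eq']
    refine Multiset.filter_congr fun a ha => ?_
    have := μ.parts_pos ha
    omega
  have hsum : (μ.parts.filter (2 ≤ ·)).sum + μ.parts.count 1 = n := by
    have h := congrArg Multiset.sum hsplit
    simpa [μ.parts_sum] using h
  obtain ⟨σ, hσ⟩ := (Equiv.Perm.exists_with_cycleType_iff (Fin n)
    (m := μ.parts.filter (2 ≤ ·))).2 ⟨by simp; omega, fun a ha => (Multiset.mem_filter.1 ha).2⟩
  refine ⟨σ, ?_⟩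
  rw [Equiv.Perm.parts_partition, ← Equiv.Perm.sum_cycleType, hσ]
  conv_rhs => rw [← hsplit]
  congr 2
  simp; omega

/-- A permutation of cycle type `μ`. -/
def permOfType {n : ℕ} (μ : n.Partition) : Equiv.Perm (Fin n) :=
  (exists_perm_of_type μ).choose

/-- The number of fixed points of the `k`-th power of a permutation of cycle type `μ`. -/
def fixPow {n : ℕ} (μ : n.Partition) (k : ℕ) : ℕ :=
  Nat.card {i : Fin n // (permOfType μ ^ k) i = i}

/-- The number of fixed points does not depend on the permutation of cycle type `μ`. -/
theorem fixPow_eq {n : ℕ} (μ : n.Partition) (k : ℕ) (σ : Equiv.Perm (Fin n))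
    (hσ : σ.partition.parts = μ.parts) :
    fixPow μ k = Nat.card {i : Fin n // (σ ^ k) i = i} := by
  have h : (permOfType μ).partition = σ.partition :=
    Nat.Partition.ext ((exists_perm_of_type μ).choose_spec.trans hσ.symm)
  obtain ⟨c, hc⟩ := isConj_iff.1 (Equiv.Perm.partition_eq_of_isConj.2 h)
  refine Nat.card_congr (c.subtypeEquiv fun i => ?_)
  rw [← hc, conj_pow]
  simp

/-- The number `λ_k` of parts of size `k` in the partition `μ`. -/
def mult {n : ℕ} (μ : n.Partition) (k : ℕ) : ℕ := μ.parts.count k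

/-- The coefficient of `p_μ / z_μ` in the expansion.  The product over all `k ≥ 2` may stop at
`n`, since `λ_k = 0` for `k > n` and the factor is then `1`.  Exponents that may be negative are
integers: for `λ_1 = 0` the first factor is `(-t)⁻¹`. -/
def expansionCoeff {n : ℕ} (μ : n.Partition) : Coef :=
  ((mult μ 1 : Coef) - tVar) ^ ((mult μ 1 : ℤ) - 1) *
    ∏ k ∈ Finset.Icc 2 n,
      (((fixPow μ k : Coef) - tVar ^ k) ^ mult μ k -
        (k : Coef) * (mult μ k : Coef) *
          ((fixPow μ k : Coef) - tVar ^ k) ^ ((mult μ k : ℤ) - 1))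

end

/-! Record a partition as an exponent d, with d k parts of size k, and let m_k(d) be the number of
points on cycles whose length is a proper divisor of k, so that f_k = k d_k + m_k. Let A_{k,n}(x) =
x (x + k n)^(n-1) / (k^n n!), with A_{k,0} = 1, and for a family u = (u_k) let F_u be the series
with coefficients ∏_k A_{k,d_k}(u_k + m_k(d)) (`forestCoeff`).

For u_k = -t^k the right-hand side is -(1/t) (F_u - 1): with w = m_k - t^k and x = f_k - t^k = w + k
d_k one has x^n - k n x^(n-1) = w x^(n-1) for n = d_k, and the division by z_d produces the
denominators k^n n!. At k = 1 the load m_1 is zero and the prefactor -(1/t) cancels the factor w =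
-t.

The left-hand side is -(1/t) (exp(∑ u_k/k · p_k∘PreLie) - 1), so everything reduces to F_u = exp(∑
u_k/k · p_k∘PreLie). Abel's binomial identity, applied one length at a time, gives F_u F_v = F_{u+v}
(`forestCoeff_convolution`). Hence c ↦ F_{cu} is a one-parameter group with polynomial coefficients,
and F_u is the exponential of its linear part in c (`coeff_exp_subst_forestHomog`). That linear part
is ∑ u_k/k · p_k∘T, where T has coefficients `treeCoeff` (`forestHomog_one_eq_finsum`).

It remains to see that T = PreLie, that is, to count the rooted trees fixed by a permutation σ
(`card_fixedTree`). Such a tree is an equivariant parent map with a fixed root. It induces a rooted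
tree on the set of cycles, and each edge c → c' of the latter lifts in l(c') ways if l(c') divides
l(c), and in no way otherwise (`card_equivariant_over`). The resulting weighted count of forests has
a product formula (`forestSum_cycleWeight`), proved by recursion on the set of vertices attached
directly to the roots. -/

noncomputable section

/-! ## Abel polynomials and their convolution identity -/

section Abel

variable {K : Type*} [Field K] [CharZero K]

/-- The Abel polynomial `X (X + k n) ^ (n - 1) / (k ^ n n!)`, equal to `1` for `n = 0`. -/
def abelPoly (k : K) (n : ℕ) : Polynomial K :=
  if n = 0 then 1 else
    Polynomial.C (1 / (k ^ n * (n.factorial : K))) *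
      (Polynomial.X * (Polynomial.X + Polynomial.C (k * n)) ^ (n - 1))

omit [CharZero K] in
theorem abelPoly_zero (k : K) : abelPoly k 0 = 1 := by simp [abelPoly]

omit [CharZero K] in
theorem abelPoly_eval {n : ℕ} (k x : K) (hn : n ≠ 0) :
    (abelPoly k n).eval x = x * (x + k * n) ^ (n - 1) / (k ^ n * (n.factorial : K)) := by
  simp [abelPoly, hn]
  ring

omit [CharZero K] in
theorem abelPoly_eval_zero {n : ℕ} (k : K) (hn : n ≠ 0) : (abelPoly k n).eval 0 = 0 := by
  simp [abelPoly_eval k 0 hn]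

/-- The Abel polynomials are the basic sequence of the delta operator p ↦ k p'(x - k); the
normalisation by k^n n! makes this operator lower the index with coefficient one. -/
theorem abelPoly_derivative {k : K} (hk : k ≠ 0) (n : ℕ) :
    Polynomial.derivative (abelPoly k (n + 1)) =
      Polynomial.C (1 / k) * (abelPoly k n).comp (Polynomial.X + Polynomial.C k) := by
  rcases n with _ | n
  · simp [abelPoly]
  · refine Polynomial.funext fun x => ?_
    have h1 : ((n.factorial : ℕ) : K) ≠ 0 := by exact_mod_cast n.factorial_ne_zero
    have h2 : (n : K) + 1 ≠ 0 := by exact_mod_cast n.succ_ne_zero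
    have h3 : (n : K) + 1 + 1 ≠ 0 := by exact_mod_cast (n + 1).succ_ne_zero
    simp only [abelPoly, Nat.add_eq_zero_iff, one_ne_zero, and_false, if_false,
      Polynomial.derivative_mul, Polynomial.derivative_C, Polynomial.derivative_X,
      Polynomial.derivative_pow, Polynomial.derivative_add, Polynomial.eval_add,
      Polynomial.eval_mul, Polynomial.eval_C, Polynomial.eval_X, Polynomial.eval_pow,
      Polynomial.eval_comp, Nat.add_sub_cancel, Nat.factorial_succ, Nat.cast_mul, Nat.cast_add,
      Nat.cast_one, Polynomial.eval_zero, Polynomial.eval_one]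
    field_simp
    ring

theorem polynomial_eq_zero_of_derivative {p : Polynomial K} (h : Polynomial.derivative p = 0)
    (h0 : p.eval 0 = 0) : p = 0 := by
  have := Polynomial.eq_C_of_derivative_eq_zero h
  rw [this, Polynomial.C_eq_zero, Polynomial.coeff_zero_eq_eval_zero, h0]

/-- Induction on n, for polynomials in x with y fixed: the derivatives agree by the lowering rule
and the induction hypothesis, and at x = 0 only the term with first index zero survives. -/
theorem abelPoly_convolution_poly {k : K} (hk : k ≠ 0) (y : K) (n : ℕ) :
    ∑ p ∈ Finset.HasAntidiagonal.antidiagonal n,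
        abelPoly k p.1 * Polynomial.C ((abelPoly k p.2).eval y) =
      (abelPoly k n).comp (Polynomial.X + Polynomial.C y) := by
  induction n with
  | zero => simp [abelPoly]
  | succ n ih =>
    rw [← sub_eq_zero]
    apply polynomial_eq_zero_of_derivative
    · rw [Finset.Nat.antidiagonal_succ, Finset.sum_cons, Finset.sum_map, Polynomial.derivative_sub,
        Polynomial.derivative_add, Polynomial.derivative_sum, Polynomial.derivative_comp,
        abelPoly_derivative hk]
      have hs : ∑ p ∈ Finset.HasAntidiagonal.antidiagonal n, Polynomial.derivative
            (abelPoly k (p.1 + 1) * Polynomial.C ((abelPoly k p.2).eval y)) =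
          Polynomial.C (1 / k) *
            ((abelPoly k n).comp (Polynomial.X + Polynomial.C y)).comp
              (Polynomial.X + Polynomial.C k) := by
        rw [← ih, ← Polynomial.coe_compRingHom_apply, map_sum, Finset.mul_sum]
        refine Finset.sum_congr rfl fun p _ => ?_
        rw [Polynomial.derivative_mul, abelPoly_derivative hk]
        simp [mul_assoc]
      erw [hs]
      simp only [abelPoly_zero, one_mul, Polynomial.derivative_C, zero_add,
        Polynomial.derivative_add, Polynomial.derivative_X, add_zero, Polynomial.mul_comp,
        Polynomial.C_comp, Polynomial.comp_assoc, Polynomial.add_comp, Polynomial.X_comp]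
      rw [sub_eq_zero, add_assoc, add_assoc, add_comm (Polynomial.C k)]
    · rw [Polynomial.eval_sub, Polynomial.eval_finsetSum, Finset.Nat.antidiagonal_succ,
        Finset.sum_cons, Finset.sum_map, Finset.sum_eq_zero]
      · simp [abelPoly_zero]
      · intro p _
        simp [abelPoly_eval_zero]

/-- Abel's binomial identity. -/
theorem abelPoly_convolution {k : K} (hk : k ≠ 0) (x y : K) (n : ℕ) :
    ∑ p ∈ Finset.HasAntidiagonal.antidiagonal n, (abelPoly k p.1).eval x * (abelPoly k p.2).eval y =
      (abelPoly k n).eval (x + y) := by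
  simpa [Polynomial.eval_finsetSum] using
    congrArg (Polynomial.eval x) (abelPoly_convolution_poly hk y n)

end Abel

/-! ## The multivariate family -/

/-- For an exponent `d`, recording `d j` cycles of length `j`, the number of points on the cycles
whose length is a proper divisor of `k`. -/
def lowerLoad (k : ℕ+) (d : ℕ+ →₀ ℕ) : ℕ :=
  d.sum fun j n => if (j : ℕ) ∣ k ∧ j ≠ k then (j : ℕ) * n else 0

theorem lowerLoad_add (k : ℕ+) (d e : ℕ+ →₀ ℕ) :
    lowerLoad k (d + e) = lowerLoad k d + lowerLoad k e := by
  unfold lowerLoad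
  refine Finsupp.sum_add_index' (fun _ => by simp) fun j m n => ?_
  split_ifs <;> ring

theorem lowerLoad_single (k j : ℕ+) (n : ℕ) :
    lowerLoad k (Finsupp.single j n) = if (j : ℕ) ∣ k ∧ j ≠ k then (j : ℕ) * n else 0 := by
  unfold lowerLoad
  rw [Finsupp.sum_single_index]
  simp

/-- Only smaller lengths contribute to the load at `k`; this triangularity allows induction on the
largest length. -/
theorem lowerLoad_single_of_le {k j : ℕ+} (h : k ≤ j) (n : ℕ) :
    lowerLoad k (Finsupp.single j n) = 0 := by
  rw [lowerLoad_single, if_neg]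
  rintro ⟨h1, h2⟩
  exact h2 (le_antisymm (Nat.le_of_dvd k.pos h1) h)

/-! ### Multiplicativity of the forest series in its parameters -/

section Forest

variable {K : Type*} [Field K] [CharZero K]

/-- The product over `k` of the Abel polynomials at `u k + lowerLoad k d`. -/
def forestCoeff (u : ℕ+ → K) (d : ℕ+ →₀ ℕ) : K :=
  ∏ k ∈ d.support, (abelPoly ((k : ℕ) : K) (d k)).eval (u k + lowerLoad k d)

omit [CharZero K] in
theorem forestCoeff_eq_prod (u : ℕ+ → K) (d : ℕ+ →₀ ℕ) {s : Finset ℕ+} (hs : d.support ⊆ s) :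
    forestCoeff u d =
      ∏ k ∈ s, (abelPoly ((k : ℕ) : K) (d k)).eval (u k + lowerLoad k d) := by
  refine Finset.prod_subset hs fun k _ hk => ?_
  rw [Finsupp.notMem_support_iff.1 hk, abelPoly_zero, Polynomial.eval_one]

omit [CharZero K] in
-- Cycles of length `a` exceeding all others do not alter the loads at the smaller lengths, so they
-- only contribute a new factor.
theorem forestCoeff_single_add (u : ℕ+ → K) (a : ℕ+) (n : ℕ) (e : ℕ+ →₀ ℕ)
    (he : ∀ c ∈ e.support, c < a) :
    forestCoeff u (Finsupp.single a n + e) =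
      (abelPoly ((a : ℕ) : K) n).eval (u a + lowerLoad a e) * forestCoeff u e := by
  have ha : a ∉ e.support := fun h => lt_irrefl _ (he a h)
  have hsub : (Finsupp.single a n + e).support ⊆ insert a e.support := by
    intro k hk
    by_cases h : k = a
    · simp [h]
    · simpa [Finsupp.single_apply, Ne.symm h, h] using hk
  rw [forestCoeff_eq_prod u _ hsub, Finset.prod_insert ha, forestCoeff]
  congr 1
  · rw [lowerLoad_add, lowerLoad_single_of_le le_rfl, zero_add, Finsupp.add_apply,
      Finsupp.single_eq_same, Finsupp.notMem_support_iff.1 ha, add_zero]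
  · refine Finset.prod_congr rfl fun k hk => ?_
    have hka := he k hk
    rw [lowerLoad_add, lowerLoad_single_of_le hka.le, zero_add, Finsupp.add_apply,
      Finsupp.single_eq_of_ne hka.ne, zero_add]

/-- As `a` is not in the support of `f`, a splitting of the sum is a splitting of `b` together with
an independent splitting of `f`. -/
theorem sum_antidiagonal_single_add {M : Type*} [AddCommMonoid M] (a : ℕ+) (b : ℕ) (f : ℕ+ →₀ ℕ)
    (ha : a ∉ f.support) (F : (ℕ+ →₀ ℕ) → (ℕ+ →₀ ℕ) → M) :
    ∑ p ∈ Finset.HasAntidiagonal.antidiagonal (Finsupp.single a b + f), F p.1 p.2 =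
      ∑ q ∈ Finset.HasAntidiagonal.antidiagonal f, ∑ r ∈ Finset.HasAntidiagonal.antidiagonal b,
        F (Finsupp.single a r.1 + q.1) (Finsupp.single a r.2 + q.2) := by
  have hfa := Finsupp.notMem_support_iff.1 ha
  rw [← Finset.sum_product']
  refine Finset.sum_nbij' (fun p => ((p.1.erase a, p.2.erase a), (p.1 a, p.2 a)))
    (fun q => (Finsupp.single a q.2.1 + q.1.1, Finsupp.single a q.2.2 + q.1.2)) ?_ ?_ ?_ ?_ ?_
  · rintro ⟨x, y⟩ h
    rw [Finset.HasAntidiagonal.mem_antidiagonal] at h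
    simp only [Finset.mem_product, Finset.HasAntidiagonal.mem_antidiagonal] at h ⊢
    refine ⟨?_, ?_⟩
    · rw [← Finsupp.erase_add, h, Finsupp.erase_add, Finsupp.erase_single, zero_add,
        Finsupp.erase_of_notMem_support ha]
    · simpa [hfa] using DFunLike.congr_fun h a
  · rintro ⟨⟨x, y⟩, i, j⟩ h
    simp only [Finset.mem_product, Finset.HasAntidiagonal.mem_antidiagonal] at h ⊢
    rw [← h.1, ← h.2, Finsupp.single_add]
    abel
  · rintro ⟨x, y⟩ -
    simp [Finsupp.single_add_erase]
  · rintro ⟨⟨x, y⟩, i, j⟩ h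
    simp only [Finset.mem_product, Finset.HasAntidiagonal.mem_antidiagonal] at h
    have h0 : x a + y a = 0 := by rw [← Finsupp.add_apply, h.1, hfa]
    have hx : a ∉ x.support := by simp; omega
    have hy : a ∉ y.support := by simp; omega
    rw [Finsupp.mem_support_iff, not_not] at hx hy
    simp [Finsupp.erase_add, hx, hy]
  · rintro ⟨x, y⟩ -
    simp [Finsupp.single_add_erase]

/-- Induction on the largest length `a`. For a fixed splitting of the smaller lengths, summing over
the splittings of `b` is Abel's identity; since loads are additive, its value does not depend on the
splitting and factors out. -/
theorem forestCoeff_convolution (u v : ℕ+ → K) (d : ℕ+ →₀ ℕ) :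
    ∑ p ∈ Finset.HasAntidiagonal.antidiagonal d, forestCoeff u p.1 * forestCoeff v p.2 =
      forestCoeff (u + v) d := by
  induction d using Finsupp.induction_on_max with
  | zero => simp [forestCoeff]
  | single_add a b f hf hb ih =>
    have ha : a ∉ f.support := fun h => lt_irrefl _ (hf a h)
    rw [sum_antidiagonal_single_add a b f ha fun x y => forestCoeff u x * forestCoeff v y,
      forestCoeff_single_add _ a b f hf, ← ih, Finset.mul_sum]
    refine Finset.sum_congr rfl fun q hq => ?_
    rw [Finset.HasAntidiagonal.mem_antidiagonal] at hq
    have h1 : ∀ c ∈ q.1.support, c < a := fun c hc => hf c (by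
      rw [← hq]; simp at hc ⊢; omega)
    have h2 : ∀ c ∈ q.2.support, c < a := fun c hc => hf c (by
      rw [← hq]; simp at hc ⊢; omega)
    have hk : ((a : ℕ) : K) ≠ 0 := by exact_mod_cast a.ne_zero
    have hload : (u + v) a + (lowerLoad a f : K) =
        (u a + lowerLoad a q.1) + (v a + lowerLoad a q.2) := by
      rw [← hq, lowerLoad_add, Pi.add_apply]; push_cast; ring
    rw [hload, ← abelPoly_convolution hk, Finset.sum_mul]
    refine Finset.sum_congr rfl fun r _ => ?_
    rw [forestCoeff_single_add u a _ _ h1, forestCoeff_single_add v a _ _ h2]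
    ring

end Forest

/-! ### The forest series as an exponential -/

section ForestExp

variable {K : Type*} [Field K]

/-- The polynomial whose value at `c` is `forestCoeff (c • u) d`. -/
def forestPoly (u : ℕ+ → K) (d : ℕ+ →₀ ℕ) : Polynomial K :=
  ∏ k ∈ d.support, (abelPoly ((k : ℕ) : K) (d k)).comp
    (Polynomial.C (u k) * Polynomial.X + Polynomial.C (lowerLoad k d : K))

theorem forestPoly_eval (u : ℕ+ → K) (d : ℕ+ →₀ ℕ) (c : K) :
    (forestPoly u d).eval c = forestCoeff (c • u) d := by
  simp [forestPoly, forestCoeff, Polynomial.eval_prod, mul_comm c]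

theorem forestPoly_zero (u : ℕ+ → K) : forestPoly u 0 = 1 := by simp [forestPoly]

/-- The series of the coefficients of degree `m` of the polynomials `forestPoly u d`. -/
def forestHomog (u : ℕ+ → K) (m : ℕ) : MvPowerSeries ℕ+ K :=
  fun d => (forestPoly u d).coeff m

theorem coeff_forestHomog (u : ℕ+ → K) (m : ℕ) (d : ℕ+ →₀ ℕ) :
    coeff d (forestHomog u m) = (forestPoly u d).coeff m := rfl

/-- The smallest length in the support has load zero, and its Abel polynomial vanishes at 0. -/
theorem forestPoly_coeff_zero [CharZero K] (u : ℕ+ → K) {d : ℕ+ →₀ ℕ} (hd : d ≠ 0) :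
    (forestPoly u d).coeff 0 = 0 := by
  have hne : d.support.Nonempty := Finsupp.support_nonempty_iff.2 hd
  set a := d.support.min' hne with ha
  have hmem : a ∈ d.support := Finset.min'_mem _ _
  have hload : lowerLoad a d = 0 := by
    refine Finset.sum_eq_zero fun j hj => if_neg ?_
    rintro ⟨h1, h2⟩
    exact h2 (le_antisymm (Nat.le_of_dvd a.pos h1) (Finset.min'_le _ _ hj))
  rw [Polynomial.coeff_zero_eq_eval_zero, forestPoly_eval, forestCoeff,
    Finset.prod_eq_zero hmem]
  rw [hload, zero_smul, Pi.zero_apply, Nat.cast_zero, zero_add,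
    abelPoly_eval_zero _ (Finsupp.mem_support_iff.1 hmem)]

theorem forestHomog_zero [CharZero K] (u : ℕ+ → K) : forestHomog u 0 = 1 := by
  classical
  ext d
  rw [coeff_forestHomog, coeff_one]
  split_ifs with h
  · simp [h, forestPoly_zero]
  · exact forestPoly_coeff_zero u h

theorem forestPoly_convolution [CharZero K] (u : ℕ+ → K) (d : ℕ+ →₀ ℕ) (x : K) :
    ∑ p ∈ Finset.HasAntidiagonal.antidiagonal d,
        Polynomial.C ((forestPoly u p.1).eval x) * forestPoly u p.2 =
      (forestPoly u d).comp (Polynomial.X + Polynomial.C x) := by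
  refine Polynomial.funext fun y => ?_
  have h := forestCoeff_convolution (x • u) (y • u) d
  rw [← add_smul, add_comm x y] at h
  simpa [Polynomial.eval_finsetSum, forestPoly_eval] using h

/-- Differentiating F_{xu} F_{yu} = F_{(x+y)u} in y at y = 0 gives the differential equation of an
exponential. -/
theorem forestPoly_derivative [CharZero K] (u : ℕ+ → K) (d : ℕ+ →₀ ℕ) :
    Polynomial.derivative (forestPoly u d) =
      ∑ p ∈ Finset.HasAntidiagonal.antidiagonal d,
        forestPoly u p.1 * Polynomial.C ((forestPoly u p.2).coeff 1) := by
  refine Polynomial.funext fun x => ?_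
  have h := congrArg (fun q => (Polynomial.derivative q).eval 0) (forestPoly_convolution u d x)
  simp only [Polynomial.derivative_sum, Polynomial.eval_finsetSum, Polynomial.derivative_C_mul,
    Polynomial.eval_mul, Polynomial.eval_C, Polynomial.derivative_comp, Polynomial.eval_comp,
    Polynomial.derivative_add, Polynomial.derivative_X, Polynomial.derivative_C, add_zero,
    one_mul, Polynomial.eval_add, Polynomial.eval_X, zero_add] at h
  rw [← h, Polynomial.eval_finsetSum]
  refine Finset.sum_congr rfl fun p _ => ?_
  rw [Polynomial.eval_mul, Polynomial.eval_C, ← Polynomial.coeff_zero_eq_eval_zero,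
    Polynomial.coeff_derivative]
  simp

/-- The coefficient of c^m in the differential equation. -/
theorem forestHomog_succ [CharZero K] (u : ℕ+ → K) (m : ℕ) :
    C ((m : K) + 1) * forestHomog u (m + 1) = forestHomog u m * forestHomog u 1 := by
  classical
  ext d
  rw [coeff_C_mul, coeff_mul]
  have h := congrArg (fun q => q.coeff m) (forestPoly_derivative u d)
  simp only [Polynomial.coeff_derivative, Polynomial.finsetSum_coeff,
    Polynomial.coeff_mul_C] at h
  rw [coeff_forestHomog, mul_comm, h]
  rfl

theorem forestHomog_eq_pow [CharZero K] (u : ℕ+ → K) (m : ℕ) :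
    forestHomog u m = C (1 / (m.factorial : K)) * forestHomog u 1 ^ m := by
  induction m with
  | zero => simp [forestHomog_zero]
  | succ m ih =>
    have hm : (m : K) + 1 ≠ 0 := by exact_mod_cast m.succ_ne_zero
    have h : forestHomog u (m + 1) =
        C (1 / ((m : K) + 1)) * (C ((m : K) + 1) * forestHomog u (m + 1)) := by
      rw [← mul_assoc, ← map_mul, one_div_mul_cancel hm, map_one, one_mul]
    rw [h, forestHomog_succ, ih, pow_succ, ← mul_assoc, ← mul_assoc, ← mul_assoc, ← map_mul,
      Nat.factorial_succ]
    push_cast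
    rw [one_div_mul_one_div]

theorem constantCoeff_forestHomog_one (u : ℕ+ → K) :
    constantCoeff (forestHomog u 1) = 0 := by
  rw [← coeff_zero_eq_constantCoeff_apply, coeff_forestHomog, forestPoly_zero,
    Polynomial.coeff_one, if_neg one_ne_zero]

theorem coeff_exp_subst_forestHomog [CharZero K] [Algebra ℚ K] (u : ℕ+ → K) (d : ℕ+ →₀ ℕ) :
    coeff d (PowerSeries.subst (forestHomog u 1) (PowerSeries.exp K)) = forestCoeff u d := by
  rw [PowerSeries.coeff_subst
    (PowerSeries.HasSubst.of_constantCoeff_zero (constantCoeff_forestHomog_one u))]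
  have h : ∀ m : ℕ, PowerSeries.coeff m (PowerSeries.exp K) • coeff d (forestHomog u 1 ^ m) =
      (forestPoly u d).coeff m := fun m => by
    rw [← coeff_forestHomog, forestHomog_eq_pow u m, coeff_C_mul, PowerSeries.coeff_exp]
    simp
  simp_rw [h]
  rw [finsum_eq_sum_of_support_subset (s := (forestPoly u d).support) _
    (fun m hm => by simpa using hm)]
  -- The sum over m of the homogeneous parts is the value of the polynomial at c = 1.
  have h1 := forestPoly_eval u d 1
  rw [one_smul, Polynomial.eval_eq_sum, Polynomial.sum] at h1
  simpa using h1

/-! ### The linear coefficient -/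

/-- The exponent obtained by replacing cycles of length `j` by cycles of length `k j`. -/
def dilate (k : ℕ+) (e : ℕ+ →₀ ℕ) : ℕ+ →₀ ℕ := e.embDomain ⟨fun j => k * j, mul_right_injective k⟩

theorem dilate_apply_mul (k j : ℕ+) (e : ℕ+ →₀ ℕ) : dilate k e (k * j) = e j :=
  Finsupp.embDomain_apply_self ⟨fun j => k * j, mul_right_injective k⟩ e j

theorem dilate_injective (k : ℕ+) : Function.Injective (dilate k) := Finsupp.embDomain_injective _

theorem dilate_zero (k : ℕ+) : dilate k 0 = 0 := Finsupp.embDomain_zero _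

theorem support_dilate (k : ℕ+) (e : ℕ+ →₀ ℕ) :
    (dilate k e).support = e.support.map ⟨fun j => k * j, mul_right_injective k⟩ :=
  Finsupp.support_embDomain _ _

theorem exists_dilate_eq {k : ℕ+} {d : ℕ+ →₀ ℕ} (h : ∀ j ∈ d.support, (k : ℕ) ∣ j) :
    ∃ e, dilate k e = d := by
  refine ⟨d.comapDomain (fun j => k * j) (mul_right_injective k).injOn, ?_⟩
  ext j
  by_cases hj : (k : ℕ) ∣ j
  · obtain ⟨i, rfl⟩ := PNat.dvd_iff.2 hj
    rw [dilate_apply_mul, Finsupp.comapDomain_apply]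
  · rw [Finsupp.notMem_support_iff.1 (fun hd => hj (h j hd)), ← Finsupp.notMem_support_iff,
      support_dilate, Finset.mem_map]
    rintro ⟨i, -, rfl⟩
    exact hj (by simp)

theorem lowerLoad_dilate (k j : ℕ+) (e : ℕ+ →₀ ℕ) :
    lowerLoad (k * j) (dilate k e) = k * lowerLoad j e := by
  rw [lowerLoad, lowerLoad, Finsupp.sum, Finsupp.sum, support_dilate, Finset.sum_map,
    Finset.mul_sum]
  refine Finset.sum_congr rfl fun i _ => ?_
  simp only [Function.Embedding.coeFn_mk, dilate_apply_mul, PNat.mul_coe, ne_eq,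
    mul_right_inj, Nat.mul_dvd_mul_iff_left k.pos, mul_ite, mul_zero, mul_assoc]

/-- Homogeneity: the numerator has degree n jointly in the variable and the length, which cancels
the power of `k` in the denominator. It makes the tree coefficients compatible with dilation. -/
theorem abelPoly_eval_mul [CharZero K] (k j : ℕ+) (n : ℕ) (x : K) :
    (abelPoly (((k * j : ℕ+) : ℕ) : K) n).eval (((k : ℕ) : K) * x) =
      (abelPoly ((j : ℕ) : K) n).eval x := by
  rcases n with _ | n
  · simp [abelPoly_zero]
  · have hk : ((k : ℕ) : K) ≠ 0 := by exact_mod_cast k.ne_zero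
    have hj : ((j : ℕ) : K) ≠ 0 := by exact_mod_cast j.ne_zero
    have hf : (((n + 1).factorial : ℕ) : K) ≠ 0 := by exact_mod_cast (n + 1).factorial_ne_zero
    rw [abelPoly_eval _ _ n.succ_ne_zero, abelPoly_eval _ _ n.succ_ne_zero]
    simp only [PNat.mul_coe, Nat.cast_mul, Nat.succ_eq_add_one, Nat.add_sub_cancel]
    rw [mul_assoc ((k : ℕ) : K) ((j : ℕ) : K), ← mul_add, mul_pow]
    field_simp
    ring

theorem abelPoly_coeff_one {n : ℕ} (k : K) (hn : n ≠ 0) :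
    (abelPoly k n).coeff 1 = (k * n) ^ (n - 1) / (k ^ n * (n.factorial : K)) := by
  rw [abelPoly, if_neg hn, Polynomial.coeff_C_mul, Polynomial.coeff_X_mul,
    Polynomial.coeff_zero_eq_eval_zero]
  simp
  ring

variable (K) in
/-- The coefficient of the series of rooted trees. -/
def treeCoeff (e : ℕ+ →₀ ℕ) : K :=
  if e 1 = 0 then 0 else
    (e 1 : K) ^ (e 1 - 1) / ((e 1).factorial : K) *
      ∏ k ∈ e.support.erase 1, (abelPoly ((k : ℕ) : K) (e k)).eval (lowerLoad k e : K)

/-- The factor at the least length `a` has load zero, hence is divisible by c; the linear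
coefficient takes its linear term and the constant terms of all other factors. -/
theorem forestPoly_coeff_one (u : ℕ+ → K) {d : ℕ+ →₀ ℕ} {a : ℕ+} (ha : a ∈ d.support)
    (hmin : ∀ j ∈ d.support, a ≤ j) :
    (forestPoly u d).coeff 1 =
      u a * ((((a : ℕ) : K) * d a) ^ (d a - 1) /
        (((a : ℕ) : K) ^ d a * ((d a).factorial : K))) *
        ∏ k ∈ d.support.erase a, (abelPoly ((k : ℕ) : K) (d k)).eval (lowerLoad k d : K) := by
  have hload : lowerLoad a d = 0 := by
    refine Finset.sum_eq_zero fun j hj => if_neg ?_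
    rintro ⟨h1, h2⟩
    exact h2 (le_antisymm (Nat.le_of_dvd a.pos h1) (hmin j hj))
  have hda := Finsupp.mem_support_iff.1 ha
  have h0 : ((abelPoly ((a : ℕ) : K) (d a)).comp
      (Polynomial.C (u a) * Polynomial.X + Polynomial.C (lowerLoad a d : K))).coeff 0 = 0 := by
    simp [Polynomial.coeff_zero_eq_eval_zero, hload, abelPoly_eval_zero _ hda]
  have h1 : ((abelPoly ((a : ℕ) : K) (d a)).comp
      (Polynomial.C (u a) * Polynomial.X + Polynomial.C (lowerLoad a d : K))).coeff 1 =
      u a * (abelPoly ((a : ℕ) : K) (d a)).coeff 1 := by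
    rw [hload, Nat.cast_zero, map_zero, add_zero, Polynomial.comp_C_mul_X_coeff, pow_one, mul_comm]
  rw [forestPoly, ← Finset.mul_prod_erase _ _ ha, Polynomial.coeff_mul,
    Finset.Nat.antidiagonal_succ]
  simp only [Finset.Nat.antidiagonal_zero, Finset.map_singleton, Finset.sum_cons,
    Finset.sum_singleton, h0, zero_mul, zero_add]
  simp only [Function.Embedding.prodMap, Function.Embedding.coeFn_mk, Prod.map,
    Function.Embedding.refl_apply, Nat.succ_eq_add_one, zero_add]
  rw [h1, abelPoly_coeff_one _ hda, Polynomial.coeff_zero_eq_eval_zero, Polynomial.eval_prod]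
  simp

/-- The series of rooted trees and its dilates are the linear coefficients. -/
theorem forestHomog_one_eq_finsum [CharZero K] (u : ℕ+ → K) (d : ℕ+ →₀ ℕ) (T : ℕ+ → K)
    (hT : ∀ k e, dilate k e = d → T k = treeCoeff K e)
    (hT' : ∀ k, (∀ e, dilate k e ≠ d) → T k = 0) :
    coeff d (forestHomog u 1) = ∑ᶠ k : ℕ+, u k / ((k : ℕ) : K) * T k := by
  rcases eq_or_ne d 0 with rfl | hd
  · rw [coeff_zero_eq_constantCoeff_apply, constantCoeff_forestHomog_one,
      finsum_eq_zero_of_forall_eq_zero]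
    intro k
    rw [hT k 0 (dilate_zero k)]
    simp [treeCoeff]
  have hne : d.support.Nonempty := Finsupp.support_nonempty_iff.2 hd
  obtain ⟨a, ha, hmin⟩ : ∃ a ∈ d.support, ∀ j ∈ d.support, a ≤ j :=
    ⟨_, Finset.min'_mem _ hne, fun j hj => Finset.min'_le _ _ hj⟩
  -- Only `k = a`, the least length present, can contribute to the sum.
  rw [finsum_eq_single _ a, coeff_forestHomog, forestPoly_coeff_one u ha hmin]
  · by_cases hdil : ∀ j ∈ d.support, (a : ℕ) ∣ j
    · obtain ⟨e, rfl⟩ := exists_dilate_eq hdil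
      have hae : dilate a e a = e 1 := by
        simpa using dilate_apply_mul a 1 e
      have hK : ((a : ℕ) : K) ≠ 0 := by exact_mod_cast a.ne_zero
      rw [hae, hT a e rfl, treeCoeff, if_neg (hae ▸ Finsupp.mem_support_iff.1 ha)]
      obtain ⟨m, hm⟩ := Nat.exists_eq_succ_of_ne_zero (hae ▸ Finsupp.mem_support_iff.1 ha)
      have hprod : ∏ k ∈ (dilate a e).support.erase a,
          (abelPoly ((k : ℕ) : K) (dilate a e k)).eval (lowerLoad k (dilate a e) : K) =
          ∏ k ∈ e.support.erase 1, (abelPoly ((k : ℕ) : K) (e k)).eval (lowerLoad k e : K) := by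
        have hs : (dilate a e).support.erase a =
            (e.support.erase 1).map ⟨fun j => a * j, mul_right_injective a⟩ := by
          rw [Finset.map_erase, support_dilate]
          simp
        rw [hs, Finset.prod_map]
        refine Finset.prod_congr rfl fun k _ => ?_
        rw [Function.Embedding.coeFn_mk, dilate_apply_mul, lowerLoad_dilate, Nat.cast_mul,
          abelPoly_eval_mul]
      rw [hprod, hm]
      have hf : ((m.succ.factorial : ℕ) : K) ≠ 0 := by exact_mod_cast m.succ.factorial_ne_zero
      simp only [Nat.succ_eq_add_one, Nat.add_sub_cancel, mul_pow, pow_succ]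
      field_simp
    · rw [hT' a fun e he => hdil fun j hj => by
        rw [← he, support_dilate, Finset.mem_map] at hj
        obtain ⟨i, -, rfl⟩ := hj
        simp]
      push Not at hdil
      -- Let b be the least length present that is not a multiple of `a`. A length present and
      -- properly dividing b would again be a smaller non-multiple of `a`, so the load at b is zero
      -- and the factor at b vanishes.
      set s := d.support.filter fun j : ℕ+ => ¬ (a : ℕ) ∣ (j : ℕ)
      have hs : s.Nonempty := by
        obtain ⟨j, hj, hj'⟩ := hdil
        exact ⟨j, Finset.mem_filter.2 ⟨hj, hj'⟩⟩
      have hb := Finset.mem_filter.1 (Finset.min'_mem s hs)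
      set b := s.min' hs
      have hload : lowerLoad b d = 0 := by
        refine Finset.sum_eq_zero fun j hj => if_neg ?_
        rintro ⟨h1, h2⟩
        refine h2 (le_antisymm (Nat.le_of_dvd b.pos h1) (Finset.min'_le _ _ ?_))
        exact Finset.mem_filter.2 ⟨hj, fun h => hb.2 (h.trans h1)⟩
      rw [Finset.prod_eq_zero (i := b), mul_zero, mul_zero]
      · exact Finset.mem_erase.2 ⟨fun h => hb.2 (h ▸ dvd_rfl), hb.1⟩
      · rw [hload, Nat.cast_zero, abelPoly_eval_zero _ (Finsupp.mem_support_iff.1 hb.1)]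
  -- If `d` is the dilate of `e` by `k` and `e 1 ≠ 0`, then `k` is itself a length present and
  -- divides all others, so `k = a`. Otherwise `treeCoeff` is zero by its first case.
  · intro k hk
    by_cases hex : ∃ e, dilate k e = d
    · obtain ⟨e, rfl⟩ := hex
      rw [hT k e rfl, treeCoeff, if_pos, mul_zero]
      by_contra h1
      rw [← dilate_apply_mul k 1 e, mul_one] at h1
      have h2 := hmin k (Finsupp.mem_support_iff.2 h1)
      rw [support_dilate, Finset.mem_map] at ha
      obtain ⟨i, -, rfl⟩ := ha
      refine hk (le_antisymm ?_ h2)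
      exact PNat.le_of_dvd (Dvd.intro _ rfl)
    · push Not at hex
      rw [hT' k hex, mul_zero]

end ForestExp

/-! ## Weighted functional forests -/

section FunctionalForest

variable {C : Type*} [Fintype C] {K : Type*} [Field K]

/-- The maps which fix the complement of `S` and lead every element of `S` to `R`. -/
def IsForestMap (S R : Finset C) (φ : C → C) : Prop :=
  (∀ c, c ∉ S → φ c = c) ∧ ∀ c ∈ S, ∃ m : ℕ, φ^[m] c ∈ R

open Classical in
/-- The sum over all forests on `S` attached to `R` of the products of the weights of the edges. -/
def forestSum (w : C → C → K) (S R : Finset C) : K :=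
  ∑ φ : C → C with IsForestMap S R φ, ∏ c ∈ S, w c (φ c)

omit [Fintype C] in
theorem iterate_mem_of_not_mem {S R : Finset C} {φ : C → C} (h : ∀ c, c ∉ S → φ c = c) {c : C}
    {m : ℕ} (hc : c ∉ S) (hm : φ^[m] c ∈ R) : c ∈ R := by
  rwa [Function.iterate_fixed (h c hc)] at hm

theorem forestSum_empty (w : C → C → K) (R : Finset C) : forestSum w ∅ R = 1 := by
  classical
  have h : (Finset.univ.filter fun φ : C → C => IsForestMap ∅ R φ) = {id} := by
    ext φ
    simp [IsForestMap, funext_iff]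
  rw [forestSum, h]
  simp

theorem forestSum_empty_right (w : C → C → K) {S : Finset C} (hS : S.Nonempty) :
    forestSum w S ∅ = 0 := by
  classical
  refine Finset.sum_eq_zero fun φ hφ => ?_
  obtain ⟨c, hc⟩ := hS
  obtain ⟨m, hm⟩ := (Finset.mem_filter.1 hφ).2.2 c hc
  simp at hm

open Classical in
-- A forest in which exactly the elements of `I` are mapped into `R` is an arbitrary map from `I` to
-- `R` together with a forest on `S \ I` attached to `I`.
theorem forestSum_fiber (w : C → C → K) {S R I : Finset C} (hSR : Disjoint S R) (hI : I ⊆ S) :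
    ∑ φ : C → C with IsForestMap S R φ ∧ S.filter (fun c => φ c ∈ R) = I, ∏ c ∈ S, w c (φ c) =
      (∏ c ∈ I, ∑ c' ∈ R, w c c') * forestSum w (S \ I) I := by
  -- Maps from `I` to `R` are encoded as self-maps of `C` that are the identity off `I`.
  have h1 : ∏ c ∈ I, ∑ c' ∈ R, w c c' =
      ∑ h ∈ Fintype.piFinset fun c => if c ∈ I then R else {c}, ∏ c ∈ I, w c (h c) := by
    have := Finset.prod_univ_sum (fun c => if c ∈ I then R else {c})
      (fun c c' => if c ∈ I then w c c' else 1)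
    rw [← Finset.prod_subset (Finset.subset_univ I)] at this
    · calc _ = _ := Finset.prod_congr rfl fun c hc => by simp [hc]
        _ = _ := this
        _ = _ := Finset.sum_congr rfl fun h _ => by
          rw [Finset.prod_ite, Finset.prod_const_one, mul_one]
          congr 1
          ext; simp
    · intro c _ hc
      simp [hc]
  rw [h1, forestSum, Finset.sum_mul_sum, ← Finset.sum_product']
  refine Finset.sum_nbij'
    (fun φ => (fun c => if c ∈ I then φ c else c, fun c => if c ∈ S \ I then φ c else c))
    (fun q c => if c ∈ I then q.1 c else q.2 c) ?_ ?_ ?_ ?_ ?_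
  · intro φ hφ
    simp only [Finset.mem_filter, Finset.mem_univ, true_and] at hφ
    obtain ⟨⟨hid, hreach⟩, hfib⟩ := hφ
    have hmemI : ∀ c, c ∈ I ↔ c ∈ S ∧ φ c ∈ R := fun c => by rw [← hfib, Finset.mem_filter]
    simp only [Finset.mem_product, Fintype.mem_piFinset, Finset.mem_filter, Finset.mem_univ,
      true_and]
    refine ⟨fun c => ?_, fun c hc => if_neg hc, ?_⟩
    · by_cases hc : c ∈ I
      · simpa [hc] using ((hmemI c).1 hc).2
      · simp [hc]
    · have key : ∀ m : ℕ, ∀ c ∈ S, φ^[m] c ∈ R →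
          ∃ n : ℕ, (fun c => if c ∈ S \ I then φ c else c)^[n] c ∈ I := by
        intro m
        induction m with
        | zero => intro c hc hR; exact absurd hR (Finset.disjoint_left.1 hSR hc)
        | succ m ih =>
          intro c hc hR
          rw [Function.iterate_succ_apply] at hR
          by_cases hcI : c ∈ I
          · exact ⟨0, hcI⟩
          · have hS : φ c ∈ S := by
              by_contra hS
              exact hcI ((hmemI c).2 ⟨hc, iterate_mem_of_not_mem hid hS hR⟩)
            obtain ⟨n, hn⟩ := ih _ hS hR
            refine ⟨n + 1, ?_⟩
            rw [Function.iterate_succ_apply, if_pos (Finset.mem_sdiff.2 ⟨hc, hcI⟩)]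
            exact hn
      intro c hc
      obtain ⟨m, hm⟩ := hreach c (Finset.mem_sdiff.1 hc).1
      exact key m c (Finset.mem_sdiff.1 hc).1 hm
  · rintro ⟨h, ψ⟩ hq
    simp only [Finset.mem_product, Fintype.mem_piFinset, Finset.mem_filter, Finset.mem_univ,
      true_and] at hq ⊢
    obtain ⟨hh, hid, hreach⟩ := hq
    have hhI : ∀ c ∈ I, h c ∈ R := fun c hc => by simpa [hc] using hh c
    -- A value outside `S` would be fixed by `ψ` and would never reach `I`.
    have hψ : ∀ c ∈ S, c ∉ I → ψ c ∈ S := by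
      intro c hc hcI
      obtain ⟨m, hm⟩ := hreach c (Finset.mem_sdiff.2 ⟨hc, hcI⟩)
      by_contra hS
      have hfix : ψ (ψ c) = ψ c := hid _ fun h => hS (Finset.mem_sdiff.1 h).1
      rcases m with _ | m
      · exact hcI hm
      · rw [Function.iterate_succ_apply, Function.iterate_fixed hfix] at hm
        exact hS (hI hm)
    refine ⟨⟨fun c hc => ?_, ?_⟩, ?_⟩
    · simp only [if_neg fun h => hc (hI h)]
      exact hid c fun h => hc (Finset.mem_sdiff.1 h).1
    · have key : ∀ m : ℕ, ∀ c ∈ S, ψ^[m] c ∈ I →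
          ∃ n : ℕ, (fun c => if c ∈ I then h c else ψ c)^[n] c ∈ R := by
        intro m
        induction m with
        | zero =>
          intro c hc hm
          refine ⟨1, ?_⟩
          have hm : c ∈ I := hm
          simpa [hm] using hhI c hm
        | succ m ih =>
          intro c hc hm
          by_cases hcI : c ∈ I
          · refine ⟨1, ?_⟩
            simpa [hcI] using hhI c hcI
          · rw [Function.iterate_succ_apply] at hm
            obtain ⟨n, hn⟩ := ih _ (hψ c hc hcI) hm
            refine ⟨n + 1, ?_⟩
            rw [Function.iterate_succ_apply, if_neg hcI]
            exact hn
      intro c hc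
      by_cases hcI : c ∈ I
      · exact key 0 c hc hcI
      · obtain ⟨m, hm⟩ := hreach c (Finset.mem_sdiff.2 ⟨hc, hcI⟩)
        exact key m c hc hm
    · ext c
      rw [Finset.mem_filter]
      constructor
      · rintro ⟨hc, hR⟩
        by_contra hcI
        rw [if_neg hcI] at hR
        exact Finset.disjoint_left.1 hSR (hψ c hc hcI) hR
      · intro hc
        rw [if_pos hc]
        exact ⟨hI hc, hhI c hc⟩
  · intro φ hφ
    simp only [Finset.mem_filter, Finset.mem_univ, true_and] at hφ
    funext c
    by_cases hc : c ∈ I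
    · simp [hc]
    · by_cases hS : c ∈ S
      · simp [hc, hS]
      · simp [hc, hS, hφ.1.1 c hS]
  · rintro ⟨h, ψ⟩ hq
    simp only [Finset.mem_product, Fintype.mem_piFinset, Finset.mem_filter, Finset.mem_univ,
      true_and] at hq
    refine Prod.ext (funext fun c => ?_) (funext fun c => ?_)
    · by_cases hc : c ∈ I
      · simp [hc]
      · simpa [hc, eq_comm] using hq.1 c
    · by_cases hc : c ∈ S \ I
      · simp [(Finset.mem_sdiff.1 hc).2, hc]
      · simp only [if_neg hc]
        exact (hq.2.1 c hc).symm
  · intro φ _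
    rw [← Finset.prod_sdiff hI, mul_comm]
    congr 1
    · exact Finset.prod_congr rfl fun c hc => by simp [hc]
    · exact Finset.prod_congr rfl fun c hc => by simp only [if_pos hc]

open Classical in
/-- Classifying forests by the set of the elements which are mapped to `R`. -/
theorem forestSum_eq_sum_powerset (w : C → C → K) {S R : Finset C} (hSR : Disjoint S R) :
    forestSum w S R =
      ∑ I ∈ S.powerset, (∏ c ∈ I, ∑ c' ∈ R, w c c') * forestSum w (S \ I) I := by
  rw [forestSum, ← Finset.sum_fiberwise_of_maps_to
    (g := fun φ : C → C => S.filter fun c => φ c ∈ R) (t := S.powerset)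
    (fun φ _ => Finset.mem_powerset.2 (Finset.filter_subset _ _))]
  refine Finset.sum_congr rfl fun I hI => ?_
  rw [← forestSum_fiber w hSR (Finset.mem_powerset.1 hI), Finset.filter_filter]

end FunctionalForest

/-! ## Summation over subsets with prescribed numbers of elements of each length -/

section Length

variable {C : Type*} (l : C → ℕ+)

/-- The number of elements of each length. -/
def lengthCount (S : Finset C) : ℕ+ →₀ ℕ := ∑ c ∈ S, Finsupp.single (l c) 1

theorem lengthCount_apply (S : Finset C) (k : ℕ+) :
    lengthCount l S k = (S.filter fun c => l c = k).card := by
  rw [lengthCount, Finsupp.finsetSum_apply, Finset.card_filter]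
  exact Finset.sum_congr rfl fun c _ => Finsupp.single_apply

theorem lengthCount_add_sdiff [DecidableEq C] {S I : Finset C} (hI : I ⊆ S) :
    lengthCount l I + lengthCount l (S \ I) = lengthCount l S := by
  rw [lengthCount, lengthCount, lengthCount, add_comm, Finset.sum_sdiff hI]

/-- The number of points in `R` whose cycle length divides `k`. -/
def divisorLoad (k : ℕ+) (R : Finset C) : ℕ := ∑ c ∈ R, if (l c : ℕ) ∣ k then (l c : ℕ) else 0

theorem divisorLoad_eq (k : ℕ+) (R : Finset C) :
    divisorLoad l k R = k * lengthCount l R k + lowerLoad k (lengthCount l R) := by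
  classical
  induction R using Finset.induction_on with
  | empty => simp [divisorLoad, lengthCount, lowerLoad]
  | insert c R hc ih =>
    have h1 : lengthCount l (insert c R) = Finsupp.single (l c) 1 + lengthCount l R :=
      Finset.sum_insert hc
    have h2 : divisorLoad l k (insert c R) =
        (if (l c : ℕ) ∣ k then (l c : ℕ) else 0) + divisorLoad l k R := Finset.sum_insert hc
    rw [h1, h2, ih, lowerLoad_add, lowerLoad_single, Finsupp.add_apply, Finsupp.single_apply]
    by_cases h : l c = k
    · simp [h]; ring
    · simp [h]; ring

/-- Choosing a subset of `S` amounts to choosing independently a subset of each length class. -/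
theorem sum_powerset_prod_length {K : Type*} [CommRing K] (S : Finset C) (T : Finset ℕ+)
    (hT : ∀ c ∈ S, l c ∈ T) (G : ℕ+ → ℕ → K) :
    ∑ I ∈ S.powerset, ∏ k ∈ T, G k (lengthCount l I k) =
      ∏ k ∈ T, ∑ J ∈ (S.filter fun c => l c = k).powerset, G k J.card := by
  classical
  induction S using Finset.induction_on generalizing G with
  | empty => simp [lengthCount]
  | insert a S ha ih =>
    have haT : l a ∈ T := hT a (Finset.mem_insert_self _ _)
    have hST : ∀ c ∈ S, l c ∈ T := fun c hc => hT c (Finset.mem_insert_of_mem hc)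
    rw [Finset.sum_powerset_insert ha, ← Finset.sum_add_distrib]
    -- `G'` absorbs the choice of whether the new element `a` belongs to the subset; only the factor
    -- at `l a` is affected.
    set G' : ℕ+ → ℕ → K := fun k n => if k = l a then G k n + G k (n + 1) else G k n
    have hstep : ∀ I ∈ S.powerset,
        ∏ k ∈ T, G k (lengthCount l I k) + ∏ k ∈ T, G k (lengthCount l (insert a I) k) =
          ∏ k ∈ T, G' k (lengthCount l I k) := by
      intro I hI
      have haI : a ∉ I := fun h => ha (Finset.mem_powerset.1 hI h)
      have h1 : lengthCount l (insert a I) = Finsupp.single (l a) 1 + lengthCount l I :=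
        Finset.sum_insert haI
      rw [← Finset.mul_prod_erase _ _ haT, ← Finset.mul_prod_erase _ _ haT,
        ← Finset.mul_prod_erase _ _ haT, h1]
      have h2 : ∏ k ∈ T.erase (l a), G k ((Finsupp.single (l a) 1 + lengthCount l I : ℕ+ →₀ ℕ) k) =
          ∏ k ∈ T.erase (l a), G k (lengthCount l I k) :=
        Finset.prod_congr rfl fun k hk => by
          simp [Finsupp.single_eq_of_ne (Finset.ne_of_mem_erase hk)]
      have h3 : ∏ k ∈ T.erase (l a), G' k (lengthCount l I k) =
          ∏ k ∈ T.erase (l a), G k (lengthCount l I k) :=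
        Finset.prod_congr rfl fun k hk => if_neg (Finset.ne_of_mem_erase hk)
      rw [h2, h3, ← add_mul]
      simp [G', add_comm]
    rw [Finset.sum_congr rfl hstep, ih hST]
    refine Finset.prod_congr rfl fun k _ => ?_
    by_cases hk : l a = k
    · rw [Finset.filter_insert, if_pos hk, Finset.sum_powerset_insert (by simp [ha]),
        ← Finset.sum_add_distrib]
      refine Finset.sum_congr rfl fun J hJ => ?_
      have haJ : a ∉ J := fun h => ha (Finset.mem_filter.1 (Finset.mem_powerset.1 hJ h)).1
      simp [G', hk, Finset.card_insert_of_notMem haJ]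
    · rw [Finset.filter_insert, if_neg hk]
      simp [G', Ne.symm hk]

/-- The numerator of the Abel polynomials. -/
def abelNum {K : Type*} [Field K] (k : K) (n : ℕ) (x : K) : K :=
  if n = 0 then 1 else x * (x + k * n) ^ (n - 1)

theorem abelNum_eq {K : Type*} [Field K] [CharZero K] {k : K} (hk : k ≠ 0) (n : ℕ) (x : K) :
    abelNum k n x = k ^ n * (n.factorial : K) * (abelPoly k n).eval x := by
  rcases eq_or_ne n 0 with rfl | hn
  · simp [abelNum, abelPoly_zero]
  · have hf : ((n.factorial : ℕ) : K) ≠ 0 := by exact_mod_cast n.factorial_ne_zero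
    rw [abelNum, if_neg hn, abelPoly_eval _ _ hn]
    field_simp

/-- This is r d/dr applied to the binomial expansion of (r + M)^(s+1). -/
theorem sum_choose_mul_pow {K : Type*} [CommRing K] (r M : K) (s : ℕ) :
    ∑ i ∈ Finset.range (s + 2), ((s + 1).choose i : K) * i * (r ^ i * M ^ (s + 1 - i)) =
      (s + 1) * r * (r + M) ^ s := by
  rw [Finset.sum_range_succ', add_pow, Finset.mul_sum]
  simp only [Nat.cast_zero, mul_zero, zero_mul, add_zero]
  refine Finset.sum_congr rfl fun i _ => ?_
  have h : ((s + 1).choose (i + 1) : K) * ((i + 1 : ℕ) : K) = (s + 1) * (s.choose i : K) := by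
    rw [← Nat.cast_mul, ← Nat.add_one_mul_choose_eq]
    push_cast
    rfl
  rw [h, Nat.add_sub_add_right]
  ring

/-- In the term of index i the base (k i + e) + k (s - i) is M = k s + e, independent of i. After
multiplication by M the sum splits into two binomial sums; this also absorbs the exceptional term i
= s, where `abelNum` is 1. -/
theorem abelNum_sum {K : Type*} [Field K] (k r e : K) (s : ℕ) (hM : s ≠ 0 → k * s + e ≠ 0) :
    ∑ i ∈ Finset.range (s + 1), (s.choose i : K) * (r ^ i * abelNum k (s - i) (k * i + e)) =
      abelNum k s (r + e) := by
  rcases s with _ | s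
  · simp [abelNum]
  have hM := hM s.succ_ne_zero
  set M := k * ((s + 1 : ℕ) : K) + e with hMdef
  have hterm : ∀ i ∈ Finset.range (s + 1 + 1),
      ((s + 1).choose i : K) * (r ^ i * abelNum k (s + 1 - i) (k * i + e)) * M =
        k * (((s + 1).choose i : K) * i * (r ^ i * M ^ (s + 1 - i))) +
          e * (r ^ i * M ^ (s + 1 - i) * ((s + 1).choose i : K)) := by
    intro i hi
    have hi : i ≤ s + 1 := Nat.lt_succ_iff.1 (Finset.mem_range.1 hi)
    rcases eq_or_lt_of_le hi with rfl | hlt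
    · rw [Nat.sub_self, abelNum, if_pos rfl, hMdef]; ring
    · have hne : s + 1 - i ≠ 0 := by omega
      obtain ⟨m, hm⟩ := Nat.exists_eq_succ_of_ne_zero hne
      have h2 : k * i + e + k * ((s + 1 - i : ℕ) : K) = M := by
        rw [hMdef, Nat.cast_sub hi]; ring
      rw [abelNum, if_neg hne, h2, hm, Nat.succ_sub_one, pow_succ M m]
      ring
  refine mul_right_cancel₀ hM ?_
  rw [Finset.sum_mul, Finset.sum_congr rfl hterm, Finset.sum_add_distrib, ← Finset.mul_sum,
    ← Finset.mul_sum, sum_choose_mul_pow, ← add_pow, abelNum, if_neg s.succ_ne_zero]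
  have h3 : r + e + k * ((s + 1 : ℕ) : K) = r + M := by rw [hMdef]; ring
  rw [h3, Nat.add_sub_cancel, pow_succ]
  push_cast at hMdef
  rw [hMdef]
  ring

/-- The number of points of a cycle of length `l c'` to which a point on a cycle of length `l c`
can be mapped by an equivariant map. -/
def cycleWeight (c c' : C) : ℚ := if (l c' : ℕ) ∣ l c then ((l c' : ℕ) : ℚ) else 0

theorem sum_cycleWeight (c : C) (R : Finset C) :
    ∑ c' ∈ R, cycleWeight l c c' = divisorLoad l (l c) R := by
  simp [cycleWeight, divisorLoad]

theorem prod_comp_length {K : Type*} [CommRing K] (I : Finset C) (T : Finset ℕ+)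
    (hT : ∀ c ∈ I, l c ∈ T) (g : ℕ+ → K) :
    ∏ c ∈ I, g (l c) = ∏ k ∈ T, g k ^ lengthCount l I k := by
  rw [← Finset.prod_fiberwise_of_maps_to hT]
  refine Finset.prod_congr rfl fun k _ => ?_
  rw [lengthCount_apply, ← Finset.prod_const]
  exact Finset.prod_congr rfl fun c hc => by rw [(Finset.mem_filter.1 hc).2]

theorem support_lengthCount_subset {S : Finset C} {T : Finset ℕ+} (hT : ∀ c ∈ S, l c ∈ T) :
    (lengthCount l S).support ⊆ T := by
  intro k hk
  rw [Finsupp.mem_support_iff, lengthCount_apply, Finset.card_ne_zero] at hk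
  obtain ⟨c, hc⟩ := hk
  obtain ⟨hcS, rfl⟩ := Finset.mem_filter.1 hc
  exact hT c hcS

/-! ### Product formula for forests weighted by cycle lengths -/

variable [Fintype C]

/-- Strong induction on the size of `S`, classifying by the set `I` mapped into `R`. The summand
depends on `I` only through the number of its elements of each length, so the sum factors over the
lengths, and each factor is `abelNum_sum`. -/
theorem forestSum_cycleWeight (S R : Finset C) (hSR : Disjoint S R) (T : Finset ℕ+)
    (hT : ∀ c ∈ S, l c ∈ T) :
    forestSum (cycleWeight l) S R =
      ∏ k ∈ T, abelNum ((k : ℕ) : ℚ) (lengthCount l S k)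
        (divisorLoad l k R + lowerLoad k (lengthCount l S)) := by
  classical
  induction hn : S.card using Nat.strong_induction_on generalizing S R with
  | _ n ih =>
  rcases S.eq_empty_or_nonempty with rfl | hS
  · rw [forestSum_empty]
    simp [lengthCount, abelNum]
  -- For `I = ∅` the remaining set is all of `S`, out of reach of the induction. Both sides are then
  -- zero, the right one because the least length in `S` has load zero.
  have hempty : forestSum (cycleWeight l) S ∅ =
      ∏ k ∈ T, abelNum ((k : ℕ) : ℚ) (lengthCount l S k)
        (divisorLoad l k ∅ + lowerLoad k (lengthCount l S)) := by
    rw [forestSum_empty_right _ hS]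
    have hne : (lengthCount l S).support.Nonempty := by
      obtain ⟨c, hc⟩ := hS
      refine ⟨l c, ?_⟩
      rw [Finsupp.mem_support_iff, lengthCount_apply, Finset.card_ne_zero]
      exact ⟨c, Finset.mem_filter.2 ⟨hc, rfl⟩⟩
    have hmem := Finset.min'_mem _ hne
    set a := (lengthCount l S).support.min' hne
    have hload : lowerLoad a (lengthCount l S) = 0 := by
      refine Finset.sum_eq_zero fun j hj => if_neg ?_
      rintro ⟨h1, h2⟩
      exact h2 (le_antisymm (Nat.le_of_dvd a.pos h1) (Finset.min'_le _ _ hj))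
    rw [Finset.prod_eq_zero (support_lengthCount_subset l hT hmem)]
    rw [abelNum, if_neg (Finsupp.mem_support_iff.1 hmem), hload]
    simp [divisorLoad]
  have hterm : ∀ I ∈ S.powerset,
      (∏ c ∈ I, ∑ c' ∈ R, cycleWeight l c c') * forestSum (cycleWeight l) (S \ I) I =
        ∏ k ∈ T, ((divisorLoad l k R : ℚ) ^ lengthCount l I k *
          abelNum ((k : ℕ) : ℚ) (lengthCount l S k - lengthCount l I k)
            (((k : ℕ) : ℚ) * lengthCount l I k + lowerLoad k (lengthCount l S))) := by
    intro I hI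
    have hI := Finset.mem_powerset.1 hI
    have hforest : forestSum (cycleWeight l) (S \ I) I =
        ∏ k ∈ T, abelNum ((k : ℕ) : ℚ) (lengthCount l (S \ I) k)
          (divisorLoad l k I + lowerLoad k (lengthCount l (S \ I))) := by
      rcases I.eq_empty_or_nonempty with rfl | hne
      · rw [Finset.sdiff_empty, hempty]
      · refine ih _ ?_ (S \ I) I Finset.sdiff_disjoint
          (fun c hc => hT c (Finset.mem_sdiff.1 hc).1) rfl
        rw [← hn]
        exact Finset.card_lt_card (Finset.sdiff_ssubset hI hne)
    rw [hforest, Finset.prod_congr rfl fun c _ => sum_cycleWeight l c R,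
      prod_comp_length l I T (fun c hc => hT c (hI hc)) fun k => (divisorLoad l k R : ℚ),
      ← Finset.prod_mul_distrib]
    refine Finset.prod_congr rfl fun k _ => ?_
    have hadd := lengthCount_add_sdiff l hI
    have h1 : lengthCount l (S \ I) k = lengthCount l S k - lengthCount l I k := by
      rw [← hadd, Finsupp.add_apply, Nat.add_sub_cancel_left]
    rw [h1]
    congr 2
    -- The loads of `I` and `S \ I` add up to that of `S`; only the number of elements of `I` of
    -- length exactly `k` remains.
    rw [divisorLoad_eq, ← hadd, lowerLoad_add]
    push_cast
    ring
  rw [forestSum_eq_sum_powerset _ hSR, Finset.sum_congr rfl hterm,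
    sum_powerset_prod_length l S T hT fun k n => (divisorLoad l k R : ℚ) ^ n *
          abelNum ((k : ℕ) : ℚ) (lengthCount l S k - n)
            (((k : ℕ) : ℚ) * n + lowerLoad k (lengthCount l S))]
  refine Finset.prod_congr rfl fun k _ => ?_
  rw [Finset.sum_powerset_apply_card (fun n => (divisorLoad l k R : ℚ) ^ n *
          abelNum ((k : ℕ) : ℚ) (lengthCount l S k - n)
            (((k : ℕ) : ℚ) * n + lowerLoad k (lengthCount l S))), ← lengthCount_apply,
    ← abelNum_sum]
  · simp
  · intro hs
    have : 0 < ((k : ℕ) : ℚ) * lengthCount l S k :=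
      mul_pos (by exact_mod_cast k.pos) (by exact_mod_cast Nat.pos_of_ne_zero hs)
    positivity

/-- The order of the centralizer of a permutation with `d k` cycles of length `k`. -/
def zExp (d : ℕ+ →₀ ℕ) : ℕ := d.prod fun k n => (k : ℕ) ^ n * n.factorial

open Classical in
-- The root has length 1, so it adds one to the load at every other length. The factor D 1 on the
-- left is the number of possible fixed roots.
theorem forestSum_root (r : C) (hr : l r = 1) :
    (lengthCount l Finset.univ 1 : ℚ) * forestSum (cycleWeight l) (Finset.univ.erase r) {r} =
      zExp (lengthCount l Finset.univ) * treeCoeff ℚ (lengthCount l Finset.univ) := by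
  set D := lengthCount l Finset.univ
  have hD : D = Finsupp.single 1 1 + lengthCount l (Finset.univ.erase r) := by
    rw [← hr]
    exact (Finset.add_sum_erase Finset.univ (fun c => Finsupp.single (l c) 1)
      (Finset.mem_univ r)).symm
  set E := lengthCount l (Finset.univ.erase r)
  have hD1 : D 1 = E 1 + 1 := by rw [hD]; simp [add_comm]
  have hDk : ∀ k, k ≠ 1 → D k = E k := fun k hk => by
    rw [hD, Finsupp.add_apply, Finsupp.single_eq_of_ne hk, zero_add]
  have hmem : (1 : ℕ+) ∈ D.support := by rw [Finsupp.mem_support_iff, hD1]; omega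
  have hT : ∀ c ∈ Finset.univ.erase r, l c ∈ D.support := fun c _ => by
    rw [Finsupp.mem_support_iff, lengthCount_apply, Finset.card_ne_zero]
    exact ⟨c, by simp⟩
  have hload : ∀ k, divisorLoad l k {r} = 1 := fun k => by simp [divisorLoad, hr]
  have hlow : ∀ k, k ≠ 1 → lowerLoad k D = 1 + lowerLoad k E := fun k hk => by
    rw [hD, lowerLoad_add, lowerLoad_single, if_pos ⟨by simp, hk.symm⟩]
    simp
  have hlow1 : lowerLoad 1 E = 0 := by
    refine Finset.sum_eq_zero fun j _ => if_neg ?_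
    rintro ⟨h1, h2⟩
    exact h2 (PNat.coe_eq_one_iff.1 (by simpa using h1))
  rw [forestSum_cycleWeight l _ _ (by simp) D.support hT, ← Finset.mul_prod_erase _ _ hmem,
    treeCoeff, if_neg (by omega), zExp, Finsupp.prod, ← Finset.mul_prod_erase _ _ hmem]
  have hprod : ∏ k ∈ D.support.erase 1, abelNum ((k : ℕ) : ℚ) (E k)
        (divisorLoad l k {r} + lowerLoad k E) =
      (∏ k ∈ D.support.erase 1, ((k : ℕ) : ℚ) ^ D k * ((D k).factorial : ℚ)) *
        ∏ k ∈ D.support.erase 1, (abelPoly ((k : ℕ) : ℚ) (D k)).eval (lowerLoad k D : ℚ) := by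
    rw [← Finset.prod_mul_distrib]
    refine Finset.prod_congr rfl fun k hk => ?_
    have hk1 := Finset.ne_of_mem_erase hk
    have hk0 : ((k : ℕ) : ℚ) ≠ 0 := by exact_mod_cast k.ne_zero
    rw [← abelNum_eq hk0, hDk k hk1, hload, hlow k hk1]
    push_cast
    rfl
  -- With E 1 = D 1 - 1 the Abel numerator is D 1 ^ (D 1 - 2), read as 1 when D 1 = 1; the extra D 1
  -- makes the exponent uniform.
  have hone : (D 1 : ℚ) * abelNum (((1 : ℕ+) : ℕ) : ℚ) (E 1) (divisorLoad l 1 {r} +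
      lowerLoad 1 E) = (D 1 : ℚ) ^ (D 1 - 1) := by
    rw [hload, hlow1, hD1, abelNum, Nat.add_sub_cancel]
    split_ifs with h
    · simp [h]
    · obtain ⟨m, hm⟩ := Nat.exists_eq_succ_of_ne_zero h
      rw [hm]
      simp only [Nat.succ_eq_add_one, Nat.add_sub_cancel, PNat.one_coe]
      push_cast
      ring
  have hf : (((D 1).factorial : ℕ) : ℚ) ≠ 0 := by exact_mod_cast (D 1).factorial_ne_zero
  rw [← mul_assoc, hone, hprod]
  push_cast
  field_simp
  simp

end Length

/-! ## Cycles of a permutation as equivalence classes of points -/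

section Cycles

variable {V : Type} [Fintype V] (σ : Equiv.Perm V)

/-- The cycles of `σ`, including the fixed points. -/
def CycleClass : Type := Quotient (Equiv.Perm.SameCycle.setoid σ)

/-- The cycle of a point. -/
def cycleClass (v : V) : CycleClass σ := Quotient.mk (Equiv.Perm.SameCycle.setoid σ) v

/-- A point on a cycle. -/
def cycleRep (c : CycleClass σ) : V := Quotient.out c

instance : Fintype (CycleClass σ) :=
  have : Finite (CycleClass σ) := Quotient.finite _
  Fintype.ofFinite _

omit [Fintype V] in
theorem cycleClass_eq_iff {v w : V} : cycleClass σ v = cycleClass σ w ↔ σ.SameCycle v w :=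
  Quotient.eq (r := Equiv.Perm.SameCycle.setoid σ)

omit [Fintype V] in
theorem cycleClass_rep (c : CycleClass σ) : cycleClass σ (cycleRep σ c) = c := Quotient.out_eq c

omit [Fintype V] in
theorem cycleClass_zpow (i : ℤ) (v : V) : cycleClass σ ((σ ^ i) v) = cycleClass σ v :=
  (cycleClass_eq_iff σ).2 (Equiv.Perm.SameCycle.symm ⟨i, rfl⟩)

omit [Fintype V] in
theorem exists_zpow_rep (v : V) : ∃ i : ℤ, (σ ^ i) (cycleRep σ (cycleClass σ v)) = v :=
  (cycleClass_eq_iff σ).1 (cycleClass_rep σ (cycleClass σ v))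

/-- The length of a cycle. -/
def cycleLength (c : CycleClass σ) : ℕ+ :=
  ⟨Function.minimalPeriod (σ • ·) (cycleRep σ c), Nat.pos_of_ne_zero
    (MulAction.minimalPeriod_pos σ (cycleRep σ c)).out⟩

theorem zpow_apply_eq_self_iff (i : ℤ) (v : V) :
    (σ ^ i) v = v ↔ ((cycleLength σ (cycleClass σ v) : ℕ) : ℤ) ∣ i := by
  obtain ⟨j, hj⟩ := exists_zpow_rep σ v
  have h := MulAction.zpow_smul_eq_iff_minimalPeriod_dvd (a := σ) (b := (cycleRep σ (cycleClass σ v)))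
    (n := i)
  rw [cycleLength, PNat.mk_coe, ← h, Equiv.Perm.smul_def]
  conv_lhs => rw [← hj, ← Equiv.Perm.mul_apply, ← zpow_add, add_comm, zpow_add,
    Equiv.Perm.mul_apply]
  exact (σ ^ j).injective.eq_iff

theorem pow_apply_eq_self_iff (k : ℕ) (v : V) :
    (σ ^ k) v = v ↔ (cycleLength σ (cycleClass σ v) : ℕ) ∣ k := by
  rw [← zpow_natCast, zpow_apply_eq_self_iff, Int.natCast_dvd_natCast]

theorem cycleLength_eq_one_iff (v : V) : cycleLength σ (cycleClass σ v) = 1 ↔ σ v = v := by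
  have h := pow_apply_eq_self_iff σ 1 v
  rw [pow_one, Nat.dvd_one, PNat.coe_eq_one_iff] at h
  exact h.symm

open Classical in
theorem card_cycleClass_fiber (c : CycleClass σ) :
    (Finset.univ.filter fun v => cycleClass σ v = c).card = cycleLength σ c := by
  rw [cycleLength, PNat.mk_coe, MulAction.minimalPeriod_eq_card, ← Fintype.card_coe]
  refine Fintype.card_congr (Equiv.subtypeEquivRight fun v => ?_)
  rw [Finset.mem_filter, MulAction.mem_orbit_iff]
  constructor
  · rintro ⟨-, rfl⟩
    obtain ⟨i, hi⟩ := exists_zpow_rep σ v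
    exact ⟨⟨σ ^ i, i, rfl⟩, hi⟩
  · rintro ⟨⟨_, i, rfl⟩, h⟩
    refine ⟨Finset.mem_univ _, ?_⟩
    rw [← h]
    exact (cycleClass_zpow σ i _).trans (cycleClass_rep σ c)

omit [Fintype V] in
theorem cycleClass_eq_of_fixed {r v : V} (hr : σ r = r) (h : cycleClass σ v = cycleClass σ r) :
    v = r := by
  obtain ⟨i, hi⟩ := (cycleClass_eq_iff σ).1 h.symm
  rw [← hi, Equiv.Perm.zpow_apply_eq_self_of_apply_eq_self hr]

open Classical in
-- Cycle by cycle: `σ ^ k` fixes every point of a cycle whose length divides `k` and no point of any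
-- other cycle.
theorem card_fixed_pow (k : ℕ+) :
    Nat.card {v : V // (σ ^ (k : ℕ)) v = v} = divisorLoad (cycleLength σ) k Finset.univ := by
  rw [Nat.card_eq_fintype_card, Fintype.card_subtype,
    Finset.card_eq_sum_card_fiberwise (f := cycleClass σ) (t := Finset.univ)
      (fun _ _ => Finset.mem_coe.2 (Finset.mem_univ _)), divisorLoad]
  refine Finset.sum_congr rfl fun c _ => ?_
  rw [Finset.filter_filter]
  split_ifs with h
  · rw [← card_cycleClass_fiber]
    congr 1
    refine Finset.filter_congr fun v _ => ⟨fun hv => hv.2, ?_⟩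
    rintro rfl
    exact ⟨(pow_apply_eq_self_iff σ k v).2 h, rfl⟩
  · rw [Finset.card_eq_zero, Finset.filter_eq_empty_iff]
    rintro v - ⟨hv, rfl⟩
    exact h ((pow_apply_eq_self_iff σ k v).1 hv)

open Classical in
theorem lengthCount_one :
    lengthCount (cycleLength σ) Finset.univ 1 = (Finset.univ.filter fun v => σ v = v).card := by
  rw [lengthCount_apply]
  symm
  refine Finset.card_nbij (cycleClass σ) ?_ ?_ ?_
  · intro v hv
    simpa [cycleLength_eq_one_iff] using hv
  · intro v _ w hw h
    exact cycleClass_eq_of_fixed σ (Finset.mem_filter.1 hw).2 h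
  · intro c hc
    refine ⟨(cycleRep σ c), ?_, cycleClass_rep σ c⟩
    have hc := (Finset.mem_filter.1 hc).2
    rw [← cycleClass_rep σ c, cycleLength_eq_one_iff] at hc
    simpa using hc

theorem card_support_cycleOf [DecidableEq V] {v : V} (hv : v ∈ σ.support) :
    (σ.cycleOf v).support.card = cycleLength σ (cycleClass σ v) := by
  classical
  rw [← card_cycleClass_fiber]
  congr 1
  ext w
  rw [Equiv.Perm.mem_support_cycleOf_iff' (Equiv.Perm.mem_support.1 hv), Finset.mem_filter,
    cycleClass_eq_iff, Equiv.Perm.sameCycle_comm]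
  simp

/-- Mathlib's cycle type omits fixed points, so length 1 is treated apart; classes of other lengths
correspond to the cycle factors of `σ`. -/
theorem lengthCount_eq_count [DecidableEq V] (k : ℕ+) :
    lengthCount (cycleLength σ) Finset.univ k = σ.partition.parts.count (k : ℕ) := by
  classical
  rw [Equiv.Perm.parts_partition, Multiset.count_add, Multiset.count_replicate]
  rcases eq_or_ne k 1 with rfl | hk
  · rw [lengthCount_one, Multiset.count_eq_zero_of_notMem fun h =>
      absurd (Equiv.Perm.two_le_of_mem_cycleType h) (by simp), PNat.one_coe, if_pos rfl, zero_add,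
      ← Finset.card_compl]
    congr 1
    ext v
    simp
  · have hk' : (1 : ℕ) ≠ k := fun h => hk (PNat.coe_eq_one_iff.1 h.symm)
    rw [if_neg hk', add_zero, Equiv.Perm.cycleType, Multiset.count_map, lengthCount_apply]
    have hsupp : ∀ c : CycleClass σ, cycleLength σ c = k → (cycleRep σ c) ∈ σ.support := fun c hc => by
      rw [Equiv.Perm.mem_support]
      intro h
      rw [← cycleLength_eq_one_iff, cycleClass_rep, hc] at h
      exact hk h
    refine Finset.card_nbij (t := σ.cycleFactorsFinset.filter fun τ =>
      (k : ℕ) = (Finset.card ∘ Equiv.Perm.support) τ) (fun c => σ.cycleOf (cycleRep σ c)) ?_ ?_ ?_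
    · intro c hc
      have hc := (Finset.mem_filter.1 hc).2
      refine Finset.mem_filter.2
        ⟨Equiv.Perm.cycleOf_mem_cycleFactorsFinset_iff.2 (hsupp c hc), ?_⟩
      rw [Function.comp_apply, card_support_cycleOf σ (hsupp c hc), cycleClass_rep, hc]
    · intro c hc c' hc' h
      have hc := (Finset.mem_filter.1 hc).2
      have hc' := (Finset.mem_filter.1 hc').2
      rw [← cycleClass_rep σ c, ← cycleClass_rep σ c', cycleClass_eq_iff]
      exact (Equiv.Perm.sameCycle_iff_cycleOf_eq_of_mem_support (hsupp c hc) (hsupp c' hc')).2 h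
    · intro τ hτ
      obtain ⟨hτ, hcard⟩ := Finset.mem_filter.1 hτ
      obtain ⟨a, ha⟩ := (Equiv.Perm.mem_cycleFactorsFinset_iff.1 hτ).1.nonempty_support
      have hτa := Equiv.Perm.cycle_is_cycleOf ha hτ
      have hout : σ.cycleOf (cycleRep σ (cycleClass σ a)) = σ.cycleOf a :=
        Equiv.Perm.SameCycle.cycleOf_eq
          ((cycleClass_eq_iff σ).1 (cycleClass_rep σ (cycleClass σ a)))
      refine ⟨cycleClass σ a, ?_, hout.trans hτa.symm⟩
      have haσ : a ∈ σ.support := Equiv.Perm.mem_cycleFactorsFinset_support_le hτ ha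
      refine Finset.mem_filter.2 ⟨Finset.mem_univ _, PNat.coe_injective ?_⟩
      rw [← card_support_cycleOf σ haσ, ← hτa]
      exact hcard.symm

/-! ## Equivariant maps -/

omit [Fintype V] in
theorem equivariant_zpow {σ : Equiv.Perm V} {f : V → V} (hf : ∀ v, f (σ v) = σ (f v)) (i : ℤ)
    (v : V) : f ((σ ^ i) v) = (σ ^ i) (f v) := by
  have hnat : ∀ (n : ℕ) v, f ((σ ^ n) v) = (σ ^ n) (f v) := by
    intro n
    induction n with
    | zero => simp
    | succ n ih => intro v; rw [pow_succ', Equiv.Perm.mul_apply, hf, ih, Equiv.Perm.mul_apply]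
  rcases Int.eq_nat_or_neg i with ⟨n, rfl | rfl⟩
  · simpa using hnat n v
  · have := hnat n ((σ ^ (-(n : ℤ))) v)
    rw [← zpow_natCast, ← Equiv.Perm.mul_apply, ← zpow_add, add_neg_cancel, zpow_zero,
      Equiv.Perm.one_apply] at this
    rw [this, ← Equiv.Perm.mul_apply, ← zpow_add, neg_add_cancel, zpow_zero,
      Equiv.Perm.one_apply]

open Classical in
-- An equivariant map is determined by its values at one representative of each cycle c. Such a
-- value may be any point of `φ c` fixed by σ^(length of c): all points if the length of `φ c`
-- divides that of c, none otherwise.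
theorem card_equivariant_over (φ : CycleClass σ → CycleClass σ) :
    ((Finset.univ.filter fun f : V → V => (∀ v, f (σ v) = σ (f v)) ∧
      ∀ v, cycleClass σ (f v) = φ (cycleClass σ v)).card : ℚ) =
      ∏ c, cycleWeight (cycleLength σ) c (φ c) := by
  set t : CycleClass σ → Finset V := fun c => Finset.univ.filter fun y =>
    cycleClass σ y = φ c ∧ (σ ^ (cycleLength σ c : ℕ)) y = y with ht
  have hcard : ∀ c, ((t c).card : ℚ) = cycleWeight (cycleLength σ) c (φ c) := by
    intro c
    rw [cycleWeight]
    split_ifs with h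
    · rw [← card_cycleClass_fiber]
      congr 2
      refine Finset.filter_congr fun v _ => ⟨fun hv => hv.1, fun hv => ⟨hv, ?_⟩⟩
      rwa [pow_apply_eq_self_iff, hv]
    · rw [Nat.cast_eq_zero, Finset.card_eq_zero, Finset.filter_eq_empty_iff]
      rintro v - ⟨hv, hv'⟩
      rw [pow_apply_eq_self_iff, hv] at hv'
      exact h hv'
  rw [← Finset.prod_congr rfl fun c _ => hcard c, ← Nat.cast_prod, ← Fintype.card_piFinset]
  congr 1
  choose j hj using exists_zpow_rep σ
  -- The extension σ^i (rep c) ↦ σ^i (y c) is well defined, because the period of `y c` divides the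
  -- length of c.
  have hinv : ∀ {y : CycleClass σ → V} {c : CycleClass σ} {i i' : ℤ}, y c ∈ t c →
      (σ ^ i) (cycleRep σ c) = (σ ^ i') (cycleRep σ c) → (σ ^ i) (y c) = (σ ^ i') (y c) := by
    intro y c i i' hy h
    have key : ∀ v, (σ ^ i) v = (σ ^ i') v ↔ (σ ^ (-i' + i)) v = v := fun v => by
      rw [zpow_add, zpow_neg, Equiv.Perm.mul_apply, Equiv.Perm.inv_eq_iff_eq]
    rw [key] at h ⊢
    rw [zpow_apply_eq_self_iff, cycleClass_rep] at h
    obtain ⟨-, hyc, hfix⟩ := Finset.mem_filter.1 hy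
    rw [pow_apply_eq_self_iff] at hfix
    rw [zpow_apply_eq_self_iff]
    exact (Int.natCast_dvd_natCast.2 hfix).trans h
  refine Finset.card_nbij' (fun f c => f (cycleRep σ c)) (fun y v => (σ ^ j v) (y (cycleClass σ v)))
    ?_ ?_ ?_ ?_
  · intro f hf
    obtain ⟨-, hf, hφ⟩ := Finset.mem_filter.1 hf
    refine Fintype.mem_piFinset.2 fun c => Finset.mem_filter.2 ⟨Finset.mem_univ _, ?_, ?_⟩
    · rw [hφ, cycleClass_rep]
    · rw [← zpow_natCast, ← equivariant_zpow hf]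
      congr 1
      rw [zpow_apply_eq_self_iff, cycleClass_rep]
  · intro y hy
    have hy := Fintype.mem_piFinset.1 hy
    refine Finset.mem_filter.2 ⟨Finset.mem_univ _, fun v => ?_, fun v => ?_⟩
    · have hc : cycleClass σ (σ v) = cycleClass σ v := by simpa using cycleClass_zpow σ 1 v
      have h1 : ∀ w, σ ((σ ^ j v) w) = (σ ^ (1 + j v)) w := fun w => by
        rw [zpow_add, zpow_one, Equiv.Perm.mul_apply]
      have h2 := hj (σ v)
      simp only
      rw [hc] at h2 ⊢
      rw [h1]
      refine hinv (hy _) ?_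
      rw [h2, ← h1, hj]
    · rw [cycleClass_zpow]
      exact (Finset.mem_filter.1 (hy (cycleClass σ v))).2.1
  · intro f hf
    obtain ⟨-, hf, -⟩ := Finset.mem_filter.1 hf
    funext v
    simp only
    rw [← equivariant_zpow hf, hj]
  · intro y hy
    have hy := Fintype.mem_piFinset.1 hy
    funext c
    have h : (σ ^ j (cycleRep σ c)) (y c) = (σ ^ (0 : ℤ)) (y c) := by
      refine hinv (hy c) ?_
      have := hj (cycleRep σ c)
      rw [cycleClass_rep] at this
      rw [this, zpow_zero, Equiv.Perm.one_apply]
    rw [zpow_zero, Equiv.Perm.one_apply] at h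
    simp only
    rwa [cycleClass_rep]

/-! ## Rooted trees fixed by a permutation -/

omit [Fintype V] in
theorem cycleClass_iterate {f : V → V} {φ : CycleClass σ → CycleClass σ}
    (h : ∀ v, cycleClass σ (f v) = φ (cycleClass σ v)) (m : ℕ) (v : V) :
    cycleClass σ (f^[m] v) = φ^[m] (cycleClass σ v) := by
  induction m with
  | zero => rfl
  | succ m ih => rw [Function.iterate_succ_apply', Function.iterate_succ_apply', h, ih]

open Classical in
-- The maps are grouped by the map they induce on cycles. Since the cycle of `r` is the single point
-- `r`, reaching `r` is the same as reaching its cycle.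
theorem card_equivariant_rooted {r : V} (hr : σ r = r) :
    ((Finset.univ.filter fun f : V → V => (∀ v, f (σ v) = σ (f v)) ∧ f r = r ∧
      ∀ v, ∃ m : ℕ, f^[m] v = r).card : ℚ) =
      forestSum (cycleWeight (cycleLength σ)) (Finset.univ.erase (cycleClass σ r))
        {cycleClass σ r} := by
  set c₀ := cycleClass σ r
  have hover : ∀ f : V → V, (∀ v, f (σ v) = σ (f v)) →
      ∀ v, cycleClass σ (f v) = cycleClass σ (f (cycleRep σ (cycleClass σ v))) := by
    intro f hf v
    obtain ⟨i, hi⟩ := exists_zpow_rep σ v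
    conv_lhs => rw [← hi, equivariant_zpow hf, cycleClass_zpow]
  rw [forestSum, Finset.card_eq_sum_card_fiberwise
    (f := fun f c => cycleClass σ (f (cycleRep σ c)))
    (t := Finset.univ.filter fun φ => IsForestMap (Finset.univ.erase c₀) {c₀} φ), Nat.cast_sum]
  · refine Finset.sum_congr rfl fun φ hφ => ?_
    obtain ⟨-, hid, hreach⟩ := Finset.mem_filter.1 hφ
    have hφ0 : φ c₀ = c₀ := hid c₀ (Finset.notMem_erase _ _)
    -- The root cycle carries weight one, so it can be included in the product over all cycles.
    have hw : cycleWeight (cycleLength σ) c₀ (φ c₀) = 1 := by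
      rw [hφ0, cycleWeight, (cycleLength_eq_one_iff σ r).2 hr]
      simp
    have hprod := Finset.mul_prod_erase Finset.univ
      (fun c => cycleWeight (cycleLength σ) c (φ c)) (Finset.mem_univ c₀)
    rw [hw, one_mul] at hprod
    rw [hprod, ← card_equivariant_over, Finset.filter_filter]
    congr 2
    refine Finset.filter_congr fun f _ => ⟨?_, ?_⟩
    · rintro ⟨⟨hf, -, -⟩, rfl⟩
      exact ⟨hf, hover f hf⟩
    · rintro ⟨hf, hφf⟩
      refine ⟨⟨hf, cycleClass_eq_of_fixed σ hr ((hφf r).trans hφ0), fun v => ?_⟩,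
        funext fun c => by rw [hφf, cycleClass_rep]⟩
      have hex : ∃ m : ℕ, φ^[m] (cycleClass σ v) = c₀ := by
        by_cases hv : cycleClass σ v = c₀
        · exact ⟨0, hv⟩
        · obtain ⟨m, hm⟩ := hreach _ (Finset.mem_erase.2 ⟨hv, Finset.mem_univ _⟩)
          exact ⟨m, Finset.mem_singleton.1 hm⟩
      obtain ⟨m, hm⟩ := hex
      exact ⟨m, cycleClass_eq_of_fixed σ hr ((cycleClass_iterate σ hφf m v).trans hm)⟩
  · intro f hf
    obtain ⟨-, hf, hfr, hreach⟩ := Finset.mem_filter.1 hf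
    refine Finset.mem_coe.2 (Finset.mem_filter.2 ⟨Finset.mem_univ _, fun c hc => ?_, fun c _ => ?_⟩)
    · have hc : c = c₀ := by simpa using hc
      subst hc
      change cycleClass σ (f (cycleRep σ (cycleClass σ r))) = cycleClass σ r
      rw [← hover f hf r, hfr]
    · obtain ⟨m, hm⟩ := hreach (cycleRep σ c)
      refine ⟨m, Finset.mem_singleton.2 ?_⟩
      have := cycleClass_iterate σ (φ := fun c => cycleClass σ (f (cycleRep σ c))) (hover f hf) m
        (cycleRep σ c)
      rw [cycleClass_rep, hm] at this
      exact this.symm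

instance (V : Type) [Finite V] : Finite (LabelledRootedTree V) :=
  Finite.of_injective (fun T => (T.root, T.parent)) fun _ _ h =>
    LabelledRootedTree.ext (congrArg Prod.fst h) (congrArg Prod.snd h)

omit [Fintype V] in
theorem smul_tree_eq_iff (T : LabelledRootedTree V) :
    σ • T = T ↔ σ T.root = T.root ∧ ∀ v, T.parent (σ v) = σ (T.parent v) := by
  rw [LabelledRootedTree.ext_iff]
  refine and_congr Iff.rfl ⟨fun h v => ?_, fun h => funext fun v => ?_⟩
  · have h1 : σ (T.parent (σ.symm (σ v))) = T.parent (σ v) := congrFun h (σ v)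
    rw [← h1, σ.symm_apply_apply]
  · change σ (T.parent (σ.symm v)) = T.parent v
    rw [← h, σ.apply_symm_apply]

/-- Rooted trees fixed by `σ` are equivariant parent maps together with a fixed root. -/
def fixedTreeEquiv : {T : LabelledRootedTree V // σ • T = T} ≃
    Σ r : {r : V // σ r = r}, {f : V → V // (∀ v, f (σ v) = σ (f v)) ∧ f r = r ∧
      ∀ v, ∃ m : ℕ, f^[m] v = r} where
  toFun T := ⟨⟨T.1.root, ((smul_tree_eq_iff σ T.1).1 T.2).1⟩, T.1.parent,
    ((smul_tree_eq_iff σ T.1).1 T.2).2, T.1.parent_root, T.1.reaches_root⟩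
  invFun p := ⟨⟨p.1.1, p.2.1, p.2.2.2.1, p.2.2.2.2⟩, (smul_tree_eq_iff σ _).2 ⟨p.1.2, p.2.2.1⟩⟩
  left_inv _ := rfl
  right_inv _ := rfl

/-- Every fixed point is the root of the same number of fixed trees; summing over roots cancels the
number of fixed points in `forestSum_root`. -/
theorem card_fixedTree :
    (Nat.card {T : LabelledRootedTree V // σ • T = T} : ℚ) =
      zExp (lengthCount (cycleLength σ) Finset.univ) *
        treeCoeff ℚ (lengthCount (cycleLength σ) Finset.univ) := by
  classical
  rw [Nat.card_congr (fixedTreeEquiv σ), Nat.card_eq_fintype_card, Fintype.card_sigma,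
    Nat.cast_sum]
  have hterm : ∀ r : {r : V // σ r = r},
      (lengthCount (cycleLength σ) Finset.univ 1 : ℚ) * (Fintype.card {f : V → V //
        (∀ v, f (σ v) = σ (f v)) ∧ f r = r ∧ ∀ v, ∃ m : ℕ, f^[m] v = r} : ℚ) =
      zExp (lengthCount (cycleLength σ) Finset.univ) *
        treeCoeff ℚ (lengthCount (cycleLength σ) Finset.univ) := by
    rintro ⟨r, hr⟩
    rw [← forestSum_root (cycleLength σ) (cycleClass σ r) ((cycleLength_eq_one_iff σ r).2 hr),
      ← card_equivariant_rooted σ hr, Fintype.card_subtype]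
  have hcard : lengthCount (cycleLength σ) Finset.univ 1 = Fintype.card {r : V // σ r = r} := by
    rw [lengthCount_one, Fintype.card_subtype]
  -- Without fixed points no tree is fixed, and `treeCoeff` is zero.
  rcases Nat.eq_zero_or_pos (lengthCount (cycleLength σ) Finset.univ 1) with h | h
  · have : IsEmpty {r : V // σ r = r} := Fintype.card_eq_zero_iff.1 (hcard.symm.trans h)
    simp [treeCoeff, h]
  · have h0 : (lengthCount (cycleLength σ) Finset.univ 1 : ℚ) ≠ 0 := by
      exact_mod_cast h.ne'
    refine mul_left_cancel₀ h0 ?_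
    rw [Finset.mul_sum, Finset.sum_congr rfl fun r _ => hterm r, Finset.sum_const, nsmul_eq_mul,
      Finset.card_univ, ← hcard]

end Cycles

/-! ## Partitions and exponents -/

section Partitions

/-- The exponent of the monomial `p_μ`. -/
def partExp {n : ℕ} (μ : n.Partition) : ℕ+ →₀ ℕ :=
  (μ.parts.map fun k => Finsupp.single k.toPNat' 1).sum

theorem multiset_sum_single_apply (m : Multiset ℕ) (hm : ∀ a ∈ m, 0 < a) (k : ℕ+) :
    (m.map fun a => Finsupp.single a.toPNat' 1 : Multiset (ℕ+ →₀ ℕ)).sum k = m.count (k : ℕ) := by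
  induction m using Multiset.induction_on with
  | empty => simp
  | cons a m ih =>
    have ha := hm a (Multiset.mem_cons_self _ _)
    have hak : a.toPNat' = k ↔ (k : ℕ) = a := by
      rw [← PNat.coe_inj, Nat.toPNat'_coe, if_pos ha, eq_comm]
    rw [Multiset.map_cons, Multiset.sum_cons, Finsupp.add_apply, Multiset.count_cons,
      ih fun b hb => hm b (Multiset.mem_cons_of_mem hb), Finsupp.single_apply, add_comm]
    simp only [hak]

theorem partExp_apply {n : ℕ} (μ : n.Partition) (k : ℕ+) :
    partExp μ k = μ.parts.count (k : ℕ) :=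
  multiset_sum_single_apply _ (fun _ h => μ.parts_pos h) k

theorem pPart_eq_monomial {n : ℕ} (μ : n.Partition) :
    pPart μ = monomial (partExp μ) (1 : Coef) := by
  unfold pPart partExp pSum
  induction μ.parts using Multiset.induction_on with
  | empty => simp
  | cons a m ih => rw [Multiset.map_cons, Multiset.prod_cons, ih, Multiset.map_cons,
      Multiset.sum_cons, X, monomial_mul_monomial, one_mul]

theorem parts_eq_of_partExp_eq {m n : ℕ} {μ : m.Partition} {ν : n.Partition}
    (h : partExp μ = partExp ν) : μ.parts = ν.parts := by
  ext k
  rcases k.eq_zero_or_pos with rfl | hk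
  · rw [Multiset.count_eq_zero_of_notMem fun h => absurd (μ.parts_pos h) (lt_irrefl _),
      Multiset.count_eq_zero_of_notMem fun h => absurd (ν.parts_pos h) (lt_irrefl _)]
  · obtain ⟨q, rfl⟩ : ∃ q : ℕ+, (q : ℕ) = k := ⟨⟨k, hk⟩, rfl⟩
    rw [← partExp_apply, ← partExp_apply, h]

theorem partExp_injective {m n : ℕ} {μ : m.Partition} {ν : n.Partition}
    (h : partExp μ = partExp ν) : m = n := by
  rw [← μ.parts_sum, ← ν.parts_sum, parts_eq_of_partExp_eq h]

/-- The total number of points of cycles whose numbers are given by `d`. -/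
def expSize (d : ℕ+ →₀ ℕ) : ℕ := d.sum fun k n => (k : ℕ) * n

theorem exists_partExp_eq (d : ℕ+ →₀ ℕ) : ∃ μ : (expSize d).Partition, partExp μ = d := by
  have hmem : ∀ a ∈ (Finsupp.toMultiset d).map ((↑) : ℕ+ → ℕ), 0 < a := by
    intro a ha
    obtain ⟨k, -, rfl⟩ := Multiset.mem_map.1 ha
    exact k.pos
  refine ⟨⟨(Finsupp.toMultiset d).map (↑), @hmem, ?_⟩, ?_⟩
  · unfold expSize
    induction d using Finsupp.induction_linear with
    | zero => simp
    | add d e hd he =>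
      rw [map_add, Multiset.map_add, Multiset.sum_add,
        hd fun a ha => hmem a (by rw [map_add, Multiset.map_add]; exact Multiset.mem_add.2 (.inl ha)),
        he fun a ha => hmem a (by rw [map_add, Multiset.map_add]; exact Multiset.mem_add.2 (.inr ha)),
        Finsupp.sum_add_index' (fun _ => mul_zero _) fun _ _ _ => mul_add _ _ _]
    | single k n => simp [Multiset.map_nsmul, Multiset.sum_nsmul, mul_comm]
  · ext k
    rw [partExp_apply, Multiset.count_map_eq_count' _ _ PNat.coe_injective,
      Finsupp.count_toMultiset]

theorem expSize_partExp {n : ℕ} (μ : n.Partition) : expSize (partExp μ) = n := by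
  obtain ⟨ν, hν⟩ := exists_partExp_eq (partExp μ)
  exact partExp_injective hν

theorem support_partExp_map {n : ℕ} (μ : n.Partition) :
    (partExp μ).support.map ⟨((↑) : ℕ+ → ℕ), PNat.coe_injective⟩ = μ.parts.toFinset := by
  ext a
  simp only [Finset.mem_map, Finsupp.mem_support_iff, partExp_apply, Multiset.mem_toFinset,
    Function.Embedding.coeFn_mk, Multiset.count_ne_zero]
  constructor
  · rintro ⟨k, hk, rfl⟩
    exact hk
  · intro ha
    exact ⟨⟨a, μ.parts_pos ha⟩, ha, rfl⟩

theorem zPart_eq_zExp {n : ℕ} (μ : n.Partition) : zPart μ = zExp (partExp μ) := by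
  rw [zPart, zExp, Finsupp.prod, ← support_partExp_map, Finset.prod_map]
  exact Finset.prod_congr rfl fun k _ => by rw [partExp_apply]; rfl

theorem card_perm_mul_zPart {n : ℕ} (μ : n.Partition) :
    (Finset.univ.filter fun σ : Equiv.Perm (Fin n) => partExp σ.partition = partExp μ).card *
      zPart μ = n.factorial := by
  set m := μ.parts.filter (2 ≤ ·) with hm
  have hcount : ∀ a, 2 ≤ a → m.count a = μ.parts.count a := fun a ha => by
    rw [hm, Multiset.count_filter, if_pos ha]
  obtain ⟨τ, hτ⟩ := exists_perm_of_type μ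
  have hτm : τ.cycleType = m := by
    rw [← Equiv.Perm.filter_parts_partition_eq_cycleType, hτ]
  have hone : n - m.sum = μ.parts.count 1 := by
    have h := lengthCount_eq_count τ 1
    rw [← hτ, Equiv.Perm.parts_partition, Multiset.count_add, Multiset.count_replicate, ← hτm,
      Multiset.count_eq_zero_of_notMem fun h => absurd (Equiv.Perm.two_le_of_mem_cycleType h)
        (by simp), if_pos rfl, zero_add, Fintype.card_fin, Equiv.Perm.sum_cycleType]
  have hfilter : (Finset.univ.filter fun σ : Equiv.Perm (Fin n) =>
      partExp σ.partition = partExp μ) = Finset.univ.filter fun σ => σ.cycleType = m := by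
    refine Finset.filter_congr fun σ _ => ⟨fun h => ?_, fun h => ?_⟩
    · rw [← Equiv.Perm.filter_parts_partition_eq_cycleType, parts_eq_of_partExp_eq h]
    · ext k
      rw [partExp_apply, partExp_apply, ← hτ, Equiv.Perm.parts_partition, h, ← hτm,
        Equiv.Perm.parts_partition, ← Equiv.Perm.sum_cycleType, ← Equiv.Perm.sum_cycleType,
        h, hτm]
  have hmain := Equiv.Perm.card_of_cycleType_mul_eq (Fin n) m
  have hcond : m.sum ≤ Fintype.card (Fin n) ∧ ∀ a ∈ m, 2 ≤ a :=
    (Equiv.Perm.exists_with_cycleType_iff (Fin n)).1 ⟨τ, hτm⟩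
  rw [if_pos hcond, Fintype.card_fin, hone] at hmain
  rw [hfilter, ← hmain]
  congr 1
  have herase : m.toFinset = μ.parts.toFinset.erase 1 := by
    ext a
    simp only [hm, Multiset.mem_toFinset, Multiset.mem_filter, Finset.mem_erase]
    constructor
    · rintro ⟨h1, h2⟩
      exact ⟨by omega, h1⟩
    · rintro ⟨h1, h2⟩
      have := μ.parts_pos h2
      exact ⟨h2, by omega⟩
  rw [Finset.prod_multiset_count m, mul_assoc, ← Finset.prod_mul_distrib, zPart]
  have hprod : ∏ k ∈ m.toFinset, k ^ m.count k * (m.count k).factorial =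
      ∏ k ∈ μ.parts.toFinset.erase 1,
        k ^ μ.parts.count k * (μ.parts.count k).factorial := by
    rw [← herase]
    refine Finset.prod_congr rfl fun k hk => ?_
    rw [hcount k (hcond.2 k (Multiset.mem_toFinset.1 hk))]
  rw [hprod]
  -- The factor of z at part size 1 is λ_1!, which is the factorial of the number of points outside
  -- the nontrivial cycles.
  by_cases h1 : 1 ∈ μ.parts.toFinset
  · rw [← Finset.mul_prod_erase _ _ h1, one_pow, one_mul]
  · rw [Finset.erase_eq_of_notMem h1, Multiset.count_eq_zero_of_notMem
      (fun h => h1 (Multiset.mem_toFinset.2 h)), Nat.factorial_zero, one_mul]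

theorem lengthCount_eq_partExp {n : ℕ} (σ : Equiv.Perm (Fin n)) :
    lengthCount (cycleLength σ) Finset.univ = partExp σ.partition := by
  ext k
  rw [partExp_apply, lengthCount_eq_count]

theorem fixPow_eq_lowerLoad {n : ℕ} (μ : n.Partition) (k : ℕ+) :
    fixPow μ k = k * partExp μ k + lowerLoad k (partExp μ) := by
  obtain ⟨σ, hσ⟩ := exists_perm_of_type μ
  have h : partExp σ.partition = partExp μ := by
    ext k
    rw [partExp_apply, partExp_apply, hσ]
  rw [fixPow_eq μ k σ hσ, card_fixed_pow, divisorLoad_eq, lengthCount_eq_partExp, h]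

end Partitions

/-! ## The series of rooted trees -/

section RootedTrees

theorem map_abelPoly_eval {K L : Type*} [Field K] [Field L] (f : K →+* L) (k : ℕ) {n : ℕ}
    (hn : n ≠ 0) (x : ℕ) :
    f ((abelPoly (k : K) n).eval (x : K)) = (abelPoly (k : L) n).eval (x : L) := by
  rw [abelPoly_eval _ _ hn, abelPoly_eval _ _ hn]
  simp

/-- The coefficients are rational numbers, so t ↦ t^k does not affect them. -/
theorem map_treeCoeff {K L : Type*} [Field K] [Field L] (f : K →+* L) (d : ℕ+ →₀ ℕ) :
    f (treeCoeff K d) = treeCoeff L d := by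
  unfold treeCoeff
  split_ifs
  · exact map_zero f
  · rw [map_mul, map_prod]
    congr 1
    · simp
    · exact Finset.prod_congr rfl fun k hk => map_abelPoly_eval f k
        (Finsupp.mem_support_iff.1 (Finset.mem_of_mem_erase hk)) _

theorem trace_ofMulAction {G H : Type} [Group G] [MulAction G H] [Finite H] (g : G) :
    LinearMap.trace ℚ _ (Representation.ofMulAction ℚ G H g) =
      (Nat.card {h : H // g • h = h} : ℚ) := by
  classical
  have := Fintype.ofFinite H
  let b : Module.Basis H ℚ (MonoidAlgebra ℚ H) :=
    Module.Basis.ofRepr (MonoidAlgebra.coeffLinearEquiv ℚ)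
  rw [LinearMap.trace_eq_matrix_trace ℚ b, Matrix.trace, Nat.card_eq_fintype_card,
    Fintype.card_subtype, Finset.card_filter, Nat.cast_sum]
  refine Finset.sum_congr rfl fun h _ => ?_
  have hb : b h = MonoidAlgebra.single h 1 := rfl
  rw [Matrix.diag_apply, LinearMap.toMatrix_apply, hb, Representation.ofMulAction_single]
  change (MonoidAlgebra.single (g • h) (1 : ℚ)).coeff h = _
  simp [Finsupp.single_apply]

/-- There are n!/z permutations of the cycle type given by `d`, each with z · `treeCoeff` fixed
trees; n! and z cancel. -/
theorem coeff_frobeniusChar_tree (n : ℕ) (d : ℕ+ →₀ ℕ) :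
    coeff d (frobeniusChar (Representation.ofMulAction ℚ (Equiv.Perm (Fin n))
      (LabelledRootedTree (Fin n)))) = if expSize d = n then treeCoeff Coef d else 0 := by
  classical
  have hσ : ∀ σ : Equiv.Perm (Fin n), coeff d (C (algebraMap ℚ Coef (LinearMap.trace ℚ _
      (Representation.ofMulAction ℚ (Equiv.Perm (Fin n)) (LabelledRootedTree (Fin n)) σ))) *
      pPart σ.partition) =
      if partExp σ.partition = d then (zExp d : Coef) * treeCoeff Coef d else 0 := by
    intro σ
    rw [pPart_eq_monomial, coeff_C_mul, coeff_monomial, trace_ofMulAction, card_fixedTree,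
      lengthCount_eq_partExp]
    by_cases h : partExp σ.partition = d
    · rw [if_pos h, if_pos h.symm, h, mul_one, map_mul, map_natCast, map_treeCoeff]
    · rw [if_neg h, if_neg (Ne.symm h), mul_zero]
  rw [frobeniusChar, coeff_C_mul, map_sum, Finset.sum_congr rfl fun σ _ => hσ σ,
    ← Finset.sum_filter, Finset.sum_const, nsmul_eq_mul]
  split_ifs with h
  · subst h
    obtain ⟨μ, hμ⟩ := exists_partExp_eq d
    have hcard := card_perm_mul_zPart μ
    rw [zPart_eq_zExp, hμ] at hcard
    have hf : (((expSize d).factorial : ℕ) : Coef) ≠ 0 := by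
      exact_mod_cast (expSize d).factorial_ne_zero
    rw [← mul_assoc (Nat.cast _), ← Nat.cast_mul, hcard, ← mul_assoc, one_div_mul_cancel hf,
      one_mul]
  · rw [Finset.filter_false_of_mem]
    · simp
    · rintro σ - rfl
      exact h ((expSize_partExp _).trans (Fintype.card_fin n))

theorem coeff_symPreLie (d : ℕ+ →₀ ℕ) : coeff d symPreLie = treeCoeff Coef d := by
  change (∑ᶠ n : ℕ, coeff d (frobeniusChar (Representation.ofMulAction ℚ (Equiv.Perm (Fin n))
    (LabelledRootedTree (Fin n))))) = _
  simp_rw [coeff_frobeniusChar_tree]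
  rw [finsum_eq_single _ (expSize d) fun n hn => if_neg (Ne.symm hn), if_pos rfl]

end RootedTrees

/-! ## The plethysm with the suspension of `Comm` -/

section Plethysm

theorem prod_pSum_eq_monomial (k : ℕ+) (e : ℕ+ →₀ ℕ) :
    (e.prod fun l n => pSum (k * l) ^ n) = monomial (dilate k e) (1 : Coef) := by
  rw [monomial_one_eq, dilate, Finsupp.prod_embDomain]
  rfl

theorem hasSubst_pSum_mul (k : ℕ+) : HasSubst fun l : ℕ+ => pSum (k * l) where
  const_coeff l := by
    rw [pSum, constantCoeff_X]
    exact IsNilpotent.zero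
  coeff_zero d := by
    classical
    refine (Set.Finite.preimage ((mul_right_injective k).injOn)
      d.support.finite_toSet).subset fun l hl => ?_
    rw [Set.mem_ofPred_eq, pSum, coeff_X] at hl
    have hd : d = Finsupp.single (k * l) 1 := by
      by_contra h
      exact hl (if_neg h)
    simp [hd]

theorem coeff_adams (k : ℕ+) (g : SymFn) (d : ℕ+ →₀ ℕ) :
    coeff d (adams k g) =
      ∑ᶠ e, coefAdams k (coeff e g) * coeff d (monomial (dilate k e) (1 : Coef)) := by
  rw [adams, coeff_subst (hasSubst_pSum_mul k)]
  exact finsum_congr fun e => by rw [prod_pSum_eq_monomial, coeff_map, smul_eq_mul]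

theorem coeff_adams_dilate (k : ℕ+) (g : SymFn) (e : ℕ+ →₀ ℕ) :
    coeff (dilate k e) (adams k g) = coefAdams k (coeff e g) := by
  classical
  rw [coeff_adams, finsum_eq_single _ e, coeff_monomial_same, mul_one]
  intro e' he'
  rw [coeff_monomial_ne (fun h => he' (dilate_injective k h).symm), mul_zero]

theorem coeff_adams_of_ne (k : ℕ+) (g : SymFn) {d : ℕ+ →₀ ℕ} (hd : ∀ e, dilate k e ≠ d) :
    coeff d (adams k g) = 0 := by
  classical
  rw [coeff_adams]
  exact finsum_eq_zero_of_forall_eq_zero fun e => by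
    rw [coeff_monomial_ne (hd e).symm, mul_zero]

/-- The scalars let the statement serve both the plethysm and its composite with the suspension. -/
theorem hasSubst_smul_adams (c : ℕ+ → Coef) {g : SymFn} (hg : constantCoeff g = 0) :
    HasSubst fun k : ℕ+ => c k • adams k g where
  const_coeff k := by
    have h : coeff (0 : ℕ+ →₀ ℕ) (adams k g) = 0 := by
      conv_lhs => rw [← dilate_zero k, coeff_adams_dilate, coeff_zero_eq_constantCoeff_apply, hg,
        map_zero]
    rw [← coeff_zero_eq_constantCoeff_apply, coeff_smul, h, mul_zero]
    exact IsNilpotent.zero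
  coeff_zero d := by
    rcases eq_or_ne d 0 with rfl | hd
    · convert Set.finite_empty
      refine Set.eq_empty_iff_forall_notMem.2 fun k hk => hk ?_
      rw [coeff_smul, ← dilate_zero k, coeff_adams_dilate, coeff_zero_eq_constantCoeff_apply, hg,
        map_zero, mul_zero]
    -- If `d` occurs in p_k∘g then `k` divides every length in `d`, in particular j, which leaves
    -- finitely many `k`.
    · obtain ⟨j, hj⟩ := Finsupp.support_nonempty_iff.2 hd
      refine (Finset.finite_toSet (Finset.Icc 1 j)).subset fun k hk => ?_
      rw [Finset.mem_coe, Finset.mem_Icc]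
      refine ⟨one_le, ?_⟩
      by_contra hlt
      refine hk ?_
      rw [coeff_smul, coeff_adams_of_ne, mul_zero]
      rintro e rfl
      rw [support_dilate, Finset.mem_map] at hj
      obtain ⟨i, -, rfl⟩ := hj
      exact hlt (PNat.le_of_dvd (Dvd.intro _ rfl))

/-- The exponent of `Comm`. -/
def powerSumLog : SymFn := formalSum fun k : ℕ+ => C (1 / ((k : ℕ) : Coef)) * pSum k

open Classical in
theorem coeff_powerSumLog (d : ℕ+ →₀ ℕ) :
    coeff d powerSumLog =
      ∑ᶠ k : ℕ+, if d = Finsupp.single k 1 then 1 / ((k : ℕ) : Coef) else 0 := by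
  change (∑ᶠ k : ℕ+, coeff d (C (1 / ((k : ℕ) : Coef)) * pSum k)) = _
  refine finsum_congr fun k => ?_
  rw [coeff_C_mul, pSum, coeff_X, mul_ite, mul_one, mul_zero]

theorem coeff_powerSumLog_single (k : ℕ+) :
    coeff (Finsupp.single k 1) powerSumLog = 1 / ((k : ℕ) : Coef) := by
  classical
  rw [coeff_powerSumLog, finsum_eq_single _ k, if_pos rfl]
  intro j hj
  rw [if_neg]
  intro h
  exact hj (Finsupp.single_left_injective one_ne_zero h).symm

theorem coeff_powerSumLog_of_ne {d : ℕ+ →₀ ℕ} (hd : ∀ k, Finsupp.single k 1 ≠ d) :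
    coeff d powerSumLog = 0 := by
  classical
  rw [coeff_powerSumLog]
  exact finsum_eq_zero_of_forall_eq_zero fun k => if_neg (hd k).symm

theorem hasSubst_powerSumLog : PowerSeries.HasSubst powerSumLog := by
  refine PowerSeries.HasSubst.of_constantCoeff_zero ?_
  rw [← coeff_zero_eq_constantCoeff_apply]
  exact coeff_powerSumLog_of_ne fun k => by simp

theorem coeff_subst_powerSumLog {a : ℕ+ → SymFn} (ha : HasSubst a) (d : ℕ+ →₀ ℕ) :
    coeff d (subst a powerSumLog) = ∑ᶠ k : ℕ+, 1 / ((k : ℕ) : Coef) * coeff d (a k) := by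
  rw [coeff_subst ha]
  have hinj : Function.Injective fun k : ℕ+ => (Finsupp.single k 1 : ℕ+ →₀ ℕ) :=
    Finsupp.single_left_injective one_ne_zero
  rw [← finsum_mem_univ, ← finsum_mem_inter_support_eq _ (Set.range fun k : ℕ+ =>
    (Finsupp.single k 1 : ℕ+ →₀ ℕ)) Set.univ ?_, finsum_mem_range hinj]
  · exact finsum_congr fun k => by
      rw [coeff_powerSumLog_single, Finsupp.prod_single_index (h := fun s n => a s ^ n)
        (pow_zero _), pow_one, smul_eq_mul]
  · ext e
    simp only [Set.mem_inter_iff, Set.mem_range, Function.mem_support, Set.mem_univ, true_and,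
      and_iff_right_iff_imp]
    intro he
    by_contra h
    push Not at h
    exact he (by rw [coeff_powerSumLog_of_ne h, zero_smul])

/-- Suspension, plethysm and exponential are all substitutions and compose. The factors -t^k belong
to the outer series, so they are not transformed by t ↦ t^k. -/
theorem plethysm_suspension_symComm {g : SymFn} (hg : constantCoeff g = 0) :
    plethysm (suspension symComm) g = C (-(1 / tVar)) *
      (PowerSeries.subst (subst (fun k : ℕ+ => (-tVar ^ (k : ℕ)) • adams k g) powerSumLog)
        (PowerSeries.exp Coef) - 1) := by
  have ha : HasSubst fun k : ℕ+ => adams k g := by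
    simpa using hasSubst_smul_adams (fun _ => 1) hg
  have hr : HasSubst ((fun k : ℕ+ => -tVar ^ (k : ℕ)) • (X : ℕ+ → SymFn)) :=
    HasSubst.smul_X _
  have hC : ∀ c : Coef, subst (fun k : ℕ+ => adams k g) (C c : SymFn) = C c := fun c =>
    subst_C c
  have h1 : subst (fun k : ℕ+ => adams k g) (1 : SymFn) = 1 := by
    rw [← map_one (C (σ := ℕ+) (R := Coef)), hC]
  have hcomm : symComm = PowerSeries.subst powerSumLog (PowerSeries.exp Coef) - 1 := rfl
  rw [plethysm, suspension, subst_mul ha, hC, hcomm, map_sub, map_one, subst_sub ha, h1,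
    rescale_eq_subst, subst_comp_subst_apply hr ha, PowerSeries.subst_def, PowerSeries.subst_def]
  have ha' : (fun s : ℕ+ => subst (fun k : ℕ+ => adams k g)
      (((fun k : ℕ+ => -tVar ^ (k : ℕ)) • (X : ℕ+ → SymFn)) s)) =
      fun k : ℕ+ => (-tVar ^ (k : ℕ)) • adams k g := by
    funext k
    rw [Pi.smul_apply', subst_smul ha, subst_X ha]
  rw [ha', subst_comp_subst_apply hasSubst_powerSumLog.const
    (hasSubst_smul_adams _ hg)]

theorem coeff_plethysm_suspension_symComm (d : ℕ+ →₀ ℕ) :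
    coeff d (plethysm (suspension symComm) symPreLie) =
      -(1 / tVar) * (forestCoeff (fun k : ℕ+ => -tVar ^ (k : ℕ)) d - coeff d (1 : SymFn)) := by
  have hg : constantCoeff symPreLie = 0 := by
    rw [← coeff_zero_eq_constantCoeff_apply, coeff_symPreLie]
    simp [treeCoeff]
  have hlog : subst (fun k : ℕ+ => (-tVar ^ (k : ℕ)) • adams k symPreLie) powerSumLog =
      forestHomog (fun k : ℕ+ => -tVar ^ (k : ℕ)) 1 := by
    ext d
    rw [coeff_subst_powerSumLog (hasSubst_smul_adams _ hg),
      forestHomog_one_eq_finsum _ d fun k => coeff d (adams k symPreLie)]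
    · refine finsum_congr fun k => ?_
      rw [coeff_smul]
      ring
    · rintro k e rfl
      rw [coeff_adams_dilate, coeff_symPreLie, map_treeCoeff]
    · intro k hk
      exact coeff_adams_of_ne k _ hk
  rw [plethysm_suspension_symComm hg, hlog, coeff_C_mul, map_sub, coeff_exp_subst_forestHomog]

end Plethysm

/-! ## The expansion -/

section Expansion

theorem tVar_ne_zero : tVar ≠ 0 := RatFunc.X_ne_zero

/-- x^m - k m x^(m-1) = (x - k m) x^(m-1) = w x^(m-1). For m = 0 the factor m kills the term with
the negative exponent. -/
theorem pow_sub_mul_zpow_div {k : Coef} {m : ℕ} {x w : Coef} (hw : x = w + k * (m : Coef)) :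
    (x ^ m - k * (m : Coef) * x ^ ((m : ℤ) - 1)) / (k ^ m * (m.factorial : Coef)) =
      (abelPoly k m).eval w := by
  rcases m with _ | m
  · simp [abelPoly_zero]
  · rw [abelPoly_eval _ _ m.succ_ne_zero, ← hw]
    congr 1
    have h : (((m + 1 : ℕ) : ℤ) - 1) = (m : ℤ) := by push_cast; ring
    rw [h, zpow_natCast, Nat.succ_sub_one, pow_succ, hw]
    ring

theorem lowerLoad_one (d : ℕ+ →₀ ℕ) : lowerLoad 1 d = 0 := by
  refine Finset.sum_eq_zero fun j _ => if_neg ?_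
  rintro ⟨h1, h2⟩
  exact h2 (PNat.coe_eq_one_iff.1 (by simpa using h1))

theorem zpow_sub_one_div {m : ℕ} :
    ((m : Coef) - tVar) ^ ((m : ℤ) - 1) / (m.factorial : Coef) =
      -(1 / tVar) * (abelPoly (1 : Coef) m).eval (-tVar) := by
  have ht := tVar_ne_zero
  rcases m with _ | m
  · simp [abelPoly_zero, zpow_neg, inv_neg]
  · have h : (((m + 1 : ℕ) : ℤ) - 1) = (m : ℤ) := by push_cast; ring
    have hf : (((m + 1).factorial : ℕ) : Coef) ≠ 0 := by exact_mod_cast (m + 1).factorial_ne_zero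
    rw [abelPoly_eval _ _ m.succ_ne_zero, h, zpow_natCast, Nat.succ_sub_one, one_pow, one_mul,
      one_mul, neg_add_eq_sub]
    field_simp

theorem expansionCoeff_div_zPart {n : ℕ} (μ : (n + 1).Partition) :
    expansionCoeff μ / (zPart μ : Coef) =
      -(1 / tVar) * forestCoeff (fun k : ℕ+ => -tVar ^ (k : ℕ)) (partExp μ) := by
  set N : ℕ+ := n.succPNat
  have hmult : ∀ k : ℕ+, mult μ k = partExp μ k := fun k => (partExp_apply μ k).symm
  have hsupp : (partExp μ).support ⊆ insert 1 (Finset.Icc 2 N) := by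
    intro k hk
    rw [Finsupp.mem_support_iff, partExp_apply, Multiset.count_ne_zero] at hk
    have hle : k ≤ N := PNat.coe_le_coe _ _ |>.1 (μ.le_of_mem_parts hk)
    rcases eq_or_ne k 1 with h | h
    · exact Finset.mem_insert.2 (Or.inl h)
    · refine Finset.mem_insert.2 (Or.inr (Finset.mem_Icc.2 ⟨?_, hle⟩))
      rw [← PNat.coe_le_coe]
      have h1 : (k : ℕ) ≠ 1 := fun h' => h (PNat.coe_eq_one_iff.1 h')
      have h2 := k.pos
      change 2 ≤ (k : ℕ)
      omega
  have hnot : (1 : ℕ+) ∉ Finset.Icc 2 N := fun h => absurd (Finset.mem_Icc.1 h).1 (by decide)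
  have hIcc : Finset.Icc 2 (n + 1) =
      (Finset.Icc (2 : ℕ+) N).map ⟨((↑) : ℕ+ → ℕ), PNat.coe_injective⟩ :=
    (PNat.map_subtype_embedding_Icc 2 N).symm
  rw [zPart_eq_zExp, zExp, Finsupp.prod_of_support_subset _ hsupp _ (by simp),
    forestCoeff_eq_prod _ _ hsupp, Finset.prod_insert hnot, Finset.prod_insert hnot,
    expansionCoeff, hIcc, Finset.prod_map]
  push_cast
  rw [mul_div_mul_comm, ← Finset.prod_div_distrib, ← mul_assoc]
  congr 1
  · have h := zpow_sub_one_div (m := partExp μ 1)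
    have h1 : mult μ 1 = partExp μ 1 := hmult 1
    rw [h1, lowerLoad_one]
    simpa using h
  · refine Finset.prod_congr rfl fun k _ => ?_
    rw [Function.Embedding.coeFn_mk, hmult, fixPow_eq_lowerLoad]
    refine pow_sub_mul_zpow_div ?_
    push_cast
    ring

theorem coeff_expansion_term {n : ℕ} (c : Coef) (μ : (n + 1).Partition) (d : ℕ+ →₀ ℕ) :
    coeff d (C c * pPart μ) = if partExp μ = d then c else 0 := by
  classical
  rw [pPart_eq_monomial, coeff_C_mul, coeff_monomial, mul_ite, mul_one, mul_zero]
  simp only [eq_comm]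

theorem sigma_partition_ext {μ ν : Σ n : ℕ, (n + 1).Partition}
    (h : partExp μ.2 = partExp ν.2) : μ = ν := by
  obtain ⟨m, μ⟩ := μ
  obtain ⟨n, ν⟩ := ν
  obtain rfl : m = n := Nat.succ_injective (partExp_injective h)
  obtain rfl : μ = ν := Nat.Partition.ext (parts_eq_of_partExp_eq h)
  rfl

end Expansion

end

/-- The sum runs over the partitions of all positive integers. -/
theorem mainTheorem5 :
    FormallySummable (fun μ : Σ n : ℕ, (n + 1).Partition =>
      C (expansionCoeff μ.2 / (zPart μ.2 : Coef)) * pPart μ.2) ∧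
    plethysm (suspension symComm) symPreLie =
      formalSum (fun μ : Σ n : ℕ, (n + 1).Partition =>
        C (expansionCoeff μ.2 / (zPart μ.2 : Coef)) * pPart μ.2) := by
  classical
  -- Each monomial occurs in at most one term, since a partition is determined by its exponent.
  refine ⟨fun d => Set.Subsingleton.finite fun μ hμ ν hν => sigma_partition_ext ?_, ?_⟩
  · have key : ∀ μ : Σ n : ℕ, (n + 1).Partition,
        coeff d (C (expansionCoeff μ.2 / (zPart μ.2 : Coef)) * pPart μ.2) ≠ 0 →
          partExp μ.2 = d := fun μ h => by
      by_contra hne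
      exact h (by rw [coeff_expansion_term, if_neg hne])
    rw [key μ hμ, key ν hν]
  · ext d
    change _ = ∑ᶠ μ : Σ n : ℕ, (n + 1).Partition,
      coeff d (C (expansionCoeff μ.2 / (zPart μ.2 : Coef)) * pPart μ.2)
    simp_rw [coeff_expansion_term]
    rw [coeff_plethysm_suspension_symComm]
    -- The constant term of the forest series is 1 and cancels the -1 coming from Comm; on the right
    -- the empty partition is excluded.
    rcases eq_or_ne d 0 with rfl | hd
    · rw [finsum_eq_zero_of_forall_eq_zero]
      · simp [forestCoeff]
      · rintro ⟨n, μ⟩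
        refine if_neg fun h => ?_
        have := expSize_partExp μ
        rw [h] at this
        simp [expSize] at this
    · obtain ⟨n, hn⟩ : ∃ n, expSize d = n + 1 := by
        refine Nat.exists_eq_succ_of_ne_zero fun h => ?_
        obtain ⟨k, hk⟩ := Finsupp.support_nonempty_iff.2 hd
        have h1 := (Finset.sum_eq_zero_iff.1 h) k hk
        exact (mul_ne_zero k.ne_zero (Finsupp.mem_support_iff.1 hk)) h1
      have hex := exists_partExp_eq d
      rw [hn] at hex
      obtain ⟨μ, rfl⟩ := hex
      rw [finsum_eq_single _ (⟨n, μ⟩ : Σ n : ℕ, (n + 1).Partition), if_pos rfl,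
        expansionCoeff_div_zPart, coeff_one, if_neg hd, sub_zero]
      exact fun ν hν => if_neg fun h => hν (sigma_partition_ext h)
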